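/- **Conventions.** $\mathbb N=\{1,2,\dots\}$. *S-sums.* For $a_i\in\mathbb N$, $b_i\in\mathbb R\setminus\{0\}$, $l\ge1$, put $$S_{a_1,\dots,a_l}(b_1,\dots,b_l;n)=\sum_{i_1=1}^{n}\frac{b_1^{i_1}}{i_1^{a_1}}\sum_{i_2=1}^{i_1}\frac{b_2^{i_2}}{i_2^{a_2}}\cdots\sum_{i_l=1}^{i_{l-1}}\frac{b_l^{i_l}}{i_l^{a_l}},$$ a sum of weight $a_1+\dots+a_l$ and depth $l$. It is an $\bar S$-sum if $b_i\in[-1,1]\setminus\{0\}$ for $2\le i\le l$ ($b_1\ne0$ is arbitrary). Sums are identified with their indices $(\mathbf a,\mathbf b)$. A sum is *smaller* than another one if it has smaller weight, or the same weight and smaller depth. *Polylogarithms.* For $x\in(0,1)$ let $H(x)=1$ for the empty word (weight $0$), $H_{0,\dots,0}(x)=\frac1{k!}(\log x)^k$ for $k\geq 1$ zeros, and otherwise $H_{m_1,\dots,m_k}(x)=\int_0^x f_{m_1}(y)H_{m_2,\dots,m_k}(y)\,dy$, with $f_0(y)=1/y$ and $f_a(y)=1/(|a|-\operatorname{sign}(a)y)$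 for $a\neq0$; the weight is $k$. It is an $\bar H$-polylogarithm if the absolute values of its nonzero letters do not increase from left to right and the last nonzero letter, if there is one, has absolute value at least $1$. The empty word is included. *Mellin transform.* Let $c\in\mathbb R\setminus\{0\}$, $d\in\{-1,1\}$ and let $s=-c/d$ be the pole of $1/(c+dx)$. Put $$M\Big(\frac{h(x)}{c+dx}\Big)(n)=\int_0^1\frac{x^n\,h(x)}{c+dx}\,dx\ \text{ if } s\notin(0,1],\qquad M\Big(\frac{h(x)}{c+dx}\Big)(n)=\int_0^1\frac{\big((x/s)^n-1\big)h(x)}{c+dx}\,dx\ \text{ if } s\in(0,1],$$ and correspondingly $\rho_{c,d}(n)=s^n$ if $s\notin(0,1]$, and $\rho_{c,d}(n)=1$ if $s\in(0,1]$. An $\bar S$-sum $S_{\mathbf a}(\mathbf b;n)$ is called *the most complicated sum* in $M\big(H_{\mathbf m}(x)/(c+dx)\big)$ if there is a real $p\ne0$ with $$M\Big(\frac{H_{\mathbf m}(x)}{c+dx}\Big)(n)=\rho_{c,d}(n)\,\big(p\,S_{\mathbf a}(\mathbf b;n)+t(n)\big)\qquad\text{for all } n\in\mathbb N,$$ where $t$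 is a finite real linear combination of $\bar S$-sums smaller than $S_{\mathbf a}(\mathbf b;n)$ and of the constant $1$. **Lemma.** 1. Let $H_{\mathbf m}(x)$, $\mathbf m=(m_1,\dots,m_k)$, $k\ge0$, be an $\bar H$-polylogarithm, $c\in\mathbb R\setminus\{0\}$ and $d\in\{-1,1\}$. The integrals defining $M(H_{\mathbf m}(x)/(c+dx))(n)$ converge absolutely, and there is exactly one most complicated sum $S_{a_1,\dots,a_l}(b_1,\dots,b_l;n)$ in this transform. Its weight is $k+1$. If $k\ge1$ and $m_k\neq1$, then $(a_l,b_l)\ne(1,1)$. 2. There is an algorithm (a program working on real numbers with exact field operations, comparisons and rational constants) that computes, from the indices of any $\bar S$-sum $S_{a_1,\dots,a_l}(b_1,\dots,b_l;n)$, an $\bar H$-polylogarithm $H_{\mathbf m}(x)$, $\mathbf m=(m_1,\dots,m_k)$, a real $c\ne0$ and $d\in\{-1,1\}$ such that the given sum is the most complicated sum in $M(H_{\mathbf m}(x)/(c+dx))$. If the sum has weight $w$, then $k=w-1$. If $(a_l,b_l)\neq(1,1)$, then $\mathbf m$ does not end in the letter $1$. If $b_i\in[-1,1]$ for all $i$,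 then $c\ge1$. 3. Consequently every $\bar S$-sum has an inverse Mellin transform in terms of $\bar H$-polylogarithms: there are finitely many $\bar H$-polylogarithms $H_{\mathbf m_j}$, reals $r_0,r_j$, nonzero reals $\alpha_j,c_j$ and signs $d_j\in\{-1,1\}$ with $$S_{\mathbf a}(\mathbf b;n)=r_0+\sum_j r_j\,\alpha_j^{\,n}\,M\Big(\frac{H_{\mathbf m_j}(x)}{c_j+d_jx}\Big)(n)\qquad\text{for all } n\in\mathbb N.$$ -/

import Mathlib

noncomputable section

namespace MellinSums

/-! ### Generalized harmonic sums -/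

/-- The word `[(a₁,b₁),…,(a_k,b_k)]` indexes the sum `S_{a₁,…,a_k}(b₁,…,b_k;n)`. -/
abbrev SWord : Type := List (ℕ × ℝ)

/-- `S_{a₁,…,a_k}(b₁,…,b_k;n) = ∑_{i₁=1}^n b₁^{i₁}/i₁^{a₁} ∑_{i₂=1}^{i₁} b₂^{i₂}/i₂^{a₂} ⋯`. -/
def sSum : SWord → ℕ → ℝ
  | [], _ => 1
  | p :: w, n => ∑ i ∈ Finset.Icc 1 n, p.2 ^ i / (i : ℝ) ^ p.1 * sSum w i

def sWeight (w : SWord) : ℕ := (w.map Prod.fst).sum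

def sDepth (w : SWord) : ℕ := w.length

/-- The order `≺`: `v` is less complicated than `w`. -/
def SLess (v w : SWord) : Prop :=
  sWeight v < sWeight w ∨ (sWeight v = sWeight w ∧ sDepth v < sDepth w)

/-- Indices of `S̄`-sums: `k ≥ 1`, `aᵢ ≥ 1`, `bᵢ ≠ 0`, and `bᵢ ∈ [-1,1]` for `i ≥ 2`. -/
def IsSBar (w : SWord) : Prop :=
  w ≠ [] ∧ (∀ p ∈ w, 1 ≤ p.1 ∧ p.2 ≠ 0) ∧ ∀ p ∈ w.tail, |p.2| ≤ 1

/-! ### Generalized polylogarithms -/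

def letterFun (a x : ℝ) : ℝ :=
  if a = 0 then 1 / x else 1 / (|a| - Real.sign a * x)

open Classical in
/-- The generalized polylogarithm `H_{m₁,…,m_k}(x)`, with `H(x) = 1` for the empty word. -/
def hpl : List ℝ → ℝ → ℝ
  | [], _ => 1
  | a :: m, x =>
    if ∀ z ∈ a :: m, z = 0 then
      Real.log x ^ (m.length + 1) / ((m.length + 1).factorial : ℝ)
    else ∫ y in (0 : ℝ)..x, letterFun a y * hpl m y

open Classical in
def nonzeroLetters (m : List ℝ) : List ℝ := m.filter (fun z => z ≠ 0)

/-- Indices of `H̄`-polylogarithms: the absolute values of the nonzero letters do not increase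
from left to right, and the last nonzero letter (if there is one) has absolute value `≥ 1`. -/
def IsHBar (m : List ℝ) : Prop :=
  (nonzeroLetters m).IsChain (fun u v => |v / u| ≤ 1) ∧
    ∀ u ∈ (nonzeroLetters m).getLast?, |1 / u| ≤ 1

/-! ### The extended Mellin transform, weight `1/(c + d x)` with `d = ±1` -/

/-- The pole of `1/(c + d x)`. -/
def pole (c d : ℝ) : ℝ := -c / d

open Classical in
/-- `x^n` if the pole is outside `(0,1]`, and `(x/s)^n - 1` if the pole `s` is in `(0,1]`. -/
def mellinKernel (c d : ℝ) (n : ℕ) (x : ℝ) : ℝ :=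
  if 0 < pole c d ∧ pole c d ≤ 1 then (x / pole c d) ^ n - 1 else x ^ n

def mellinIntegrand (h : ℝ → ℝ) (c d : ℝ) (n : ℕ) (x : ℝ) : ℝ :=
  mellinKernel c d n x * h x / (c + d * x)

/-- `M(h(x)/(c + d x))(n)`. -/
def mellinTransform (h : ℝ → ℝ) (c d : ℝ) (n : ℕ) : ℝ :=
  ∫ x in (0 : ℝ)..1, mellinIntegrand h c d n x

open Classical in
/-- The exponential prefactor of the Mellin transform: the `n`-th power of the pole, or `1` where
the kernel `(x/s)^n - 1` is already divided by it. -/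
def prefactor (c d : ℝ) (n : ℕ) : ℝ :=
  if 0 < pole c d ∧ pole c d ≤ 1 then 1 else pole c d ^ n

/-- The `S̄`-sum with index `w` is the most complicated one in `M(H_m(x)/(c + d x))`: up to the
exponential prefactor, the transform is a nonzero multiple of it plus a real linear combination
of smaller `S̄`-sums and the constant `1`. -/
def IsMostComplicated (m : List ℝ) (c d : ℝ) (w : SWord) : Prop :=
  IsSBar w ∧ ∃ (p t₀ : ℝ) (t : SWord →₀ ℝ), p ≠ 0 ∧
    (∀ v ∈ t.support, IsSBar v ∧ SLess v w) ∧
    ∀ n : ℕ, 1 ≤ n → mellinTransform (hpl m) c d n =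
      prefactor c d n * (p * sSum w n + (t₀ + t.sum (fun v r => r * sSum v n)))

/-! ### Algorithms over the reals

Programs with finitely many stacks of real numbers, exact field operations, rational constants,
sign tests and emptiness tests (a Blum–Shub–Smale type model without real constants). -/

/-- The contents of the stacks, top element first. -/
abbrev Store : Type := ℕ → List ℝ

inductive Instr : Type
  | push (k : ℕ) (q : ℚ)
  | pop (k : ℕ)
  | copy (k l : ℕ)
  | add (k : ℕ)
  | sub (k : ℕ)
  | mul (k : ℕ)
  | div (k : ℕ)

/-- Replace the two top entries `x, y` (`x` on top) of stack `k` by `f y x`;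
missing entries are read as `0`. -/
def binop (f : ℝ → ℝ → ℝ) (k : ℕ) (s : Store) : Store :=
  Function.update s k (f ((s k).tail.headD 0) ((s k).headD 0) :: (s k).tail.tail)

def Instr.run : Instr → Store → Store
  | .push k q, s => Function.update s k ((q : ℝ) :: s k)
  | .pop k, s => Function.update s k (s k).tail
  | .copy k l, s => Function.update s l ((s k).headD 0 :: s l)
  | .add k, s => binop (fun y x => y + x) k s
  | .sub k, s => binop (fun y x => y - x) k s
  | .mul k, s => binop (fun y x => y * x) k s
  | .div k, s => binop (fun y x => y / x) k s

inductive Test : Type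
  | nonempty (k : ℕ)
  | pos (k : ℕ)

def Test.holds : Test → Store → Prop
  | .nonempty k, s => s k ≠ []
  | .pos k, s => 0 < (s k).headD 0

inductive Prog : Type
  | instr (i : Instr)
  | seq (P Q : Prog)
  | branch (b : Test) (P Q : Prog)
  | loop (b : Test) (P : Prog)

/-- `Exec P s t`: the program `P`, started in `s`, halts in `t`. -/
inductive Exec : Prog → Store → Store → Prop
  | instr (i : Instr) (s : Store) : Exec (.instr i) s (i.run s)
  | seq {P Q : Prog} {s t u : Store} : Exec P s t → Exec Q t u → Exec (.seq P Q) s u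
  | branch_true {b : Test} {P Q : Prog} {s t : Store} :
      b.holds s → Exec P s t → Exec (.branch b P Q) s t
  | branch_false {b : Test} {P Q : Prog} {s t : Store} :
      ¬ b.holds s → Exec Q s t → Exec (.branch b P Q) s t
  | loop_true {b : Test} {P : Prog} {s t u : Store} :
      b.holds s → Exec P s t → Exec (.loop b P) t u → Exec (.loop b P) s u
  | loop_false {b : Test} {P : Prog} {s : Store} : ¬ b.holds s → Exec (.loop b P) s s

/-- On input `xs` in stack `0` (all other stacks empty), `P` halts with `ys` in stack `0`. -/
def Prog.Outputs (P : Prog) (xs ys : List ℝ) : Prop :=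
  ∃ t : Store, Exec P (fun k => if k = 0 then xs else []) t ∧ t 0 = ys

/-- The input `a₁, b₁, a₂, b₂, …, a_l, b_l`. -/
def encodeSWord (w : SWord) : List ℝ := w.flatMap (fun p => [(p.1 : ℝ), p.2])

end MellinSums

end

open MellinSums

/-!
Write `s = -c/d` for the pole of `1/(c + d x)` and `ρ(n)` for the prefactor. Since
`(x/s)^(n+1) - (x/s)^n` is a multiple of `x - s`, the quotients `M(n)/ρ(n)` of the transform of
`H_m(x)/(c + d x)` satisfy a first order recurrence (`mellinTransform_succ`), so
`M(n) = ρ(n) (M(0) + d ∑_{j ≤ n} s^(-j) A_m(j))` with the moments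
`A_m(j) = ∫₀¹ x^(j-1) H_m(x) dx`. Integration by parts turns the moment of a word `a :: m` into
`L/j - (1/j) A_m(j)` if `a = 0` and into `L/j - (1/j) M(H_m(x)/(|a| - sign(a) x))(j)` otherwise;
for `a = 1` the primitive `(x^j - 1)/j` replaces `x^j/j`, which is the reason for the modified
kernel of the transform. Hence, by induction on the word (`exists_moment_eq`), `A_m(j)` is a nonzero
multiple of the summand `b^j / j^a · S_v(j)` of one word `(a,b) :: v = topWord m`, plus summands of
smaller weight, and the transform has the leading sum `mellinWord m c d`, which is `topWord m` with
its first `b` divided by `s`. The analysis behind this needs only one bound: a polylogarithm that is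
not a power of `log x` is at most a multiple of `√x / √(1-x)`, whose derivative in turn dominates, up
to a constant, all integrands that occur in the iterated integrals.

For `m = 0^(a₁-1) y₂ 0^(a₂-1) ⋯ y_l 0^(a_l-1)` the leading word has the exponents `a₁, …, a_l` and
`b₁ = y₂/s` and `b_i = y_(i+1)/y_i` for `i ≥ 2`, where `y_(l+1) = 1`. This is inverted by
`s = 1/(b₁⋯b_l)` and `y_i = 1/(b_i⋯b_l)` (`poleAndLetters`), which `inverseProg` computes by reading
the input from its end. As the remaining terms have smaller weight, the inverse transform of every sum follows by
induction on the weight (`IsSBar.sSum_mem_span`).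

The most complicated sum is unique because the sums are linearly independent, and in fact the
sequences `β^n S_w(n)` are so over the field of rational functions
(`eq_zero_of_evalComb_eq_zero`). In a relation of minimal depth with as few deepest terms as
possible, make one deepest coefficient `1` and subtract the relation from a multiple of its shift
`n ↦ n + 1`. The result has fewer deepest terms, hence it is trivial; so the deepest terms have
constant coefficients and a common exponential, and the next coefficient `r` solves an equation
`q r(X+1) - r(X) + ∑ k_a / (X+1)^a = 0` with constants `k_a` that are not all zero. No rational `r`
does: its leftmost and rightmost integral poles give two different poles of `q r(X+1) - r(X)`,
while the sum over `a` has its only pole at `-1`.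
-/

noncomputable section

namespace MellinSums

section

open Set Filter Topology MeasureTheory

/-! ### Growth of the polylogarithms on the unit interval -/

/-- Every nonzero letter has absolute value at least `1`. -/
def LettersGeOne (m : List ℝ) : Prop := ∀ a ∈ m, a ≠ 0 → 1 ≤ |a|

theorem LettersGeOne.of_cons {a : ℝ} {m : List ℝ} (h : LettersGeOne (a :: m)) : LettersGeOne m :=
  fun b hb => h b (List.mem_cons_of_mem _ hb)

theorem letterFun_zero (x : ℝ) : letterFun 0 x = 1 / x := by simp [letterFun]

theorem one_sub_le_letter_denom {a x : ℝ} (ha : 1 ≤ |a|) (hx : x ∈ Ioo (0 : ℝ) 1) :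
    1 - x ≤ |a| - Real.sign a * x := by
  obtain ⟨h0, h1⟩ := hx
  rcases Real.sign_apply_eq a with h | h | h <;> rw [h] <;> linarith

theorem abs_letterFun_le {a x : ℝ} (ha : 1 ≤ |a|) (hx : x ∈ Ioo (0 : ℝ) 1) :
    |letterFun a x| ≤ 1 / (1 - x) := by
  have ha0 : a ≠ 0 := by
    rintro rfl; simp at ha; linarith
  have h1 : 0 < 1 - x := by linarith [hx.2]
  have h2 := one_sub_le_letter_denom ha hx
  rw [letterFun, if_neg ha0, abs_of_pos (one_div_pos.2 (h1.trans_le h2))]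
  exact one_div_le_one_div_of_le h1 h2

theorem continuousOn_letterFun {a : ℝ} (ha : a ≠ 0 → 1 ≤ |a|) :
    ContinuousOn (letterFun a) (Ioo 0 1) := by
  by_cases h : a = 0
  · subst h
    have : letterFun 0 = fun x => 1 / x := funext letterFun_zero
    rw [this]
    exact continuousOn_const.div continuousOn_id fun x hx => hx.1.ne'
  · have : letterFun a = fun x => 1 / (|a| - Real.sign a * x) := by
      funext x; rw [letterFun, if_neg h]
    rw [this]
    refine continuousOn_const.div (by fun_prop) fun x hx => ?_
    have := one_sub_le_letter_denom (ha h) hx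
    linarith [hx.2]

theorem measurable_letterFun (a : ℝ) : Measurable (letterFun a) := by
  unfold letterFun
  split_ifs <;> fun_prop

/-- The comparison function `√x / √(1-x)` for the polylogarithms that are not powers of `log x`. -/
def growthFun (x : ℝ) : ℝ := √x / √(1 - x)

/-- The derivative of `growthFun`. -/
def growthDeriv (x : ℝ) : ℝ := 1 / (2 * √x * √(1 - x) ^ 3)

theorem hasDerivAt_growthFun {x : ℝ} (hx : x ∈ Ioo (0 : ℝ) 1) :
    HasDerivAt growthFun (growthDeriv x) x := by
  have h1 : 0 < 1 - x := by linarith [hx.2]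
  have hs : 0 < √x := Real.sqrt_pos.2 hx.1
  have ht : 0 < √(1 - x) := Real.sqrt_pos.2 h1
  have hd1 : HasDerivAt (fun x => √x) (1 / (2 * √x)) x := Real.hasDerivAt_sqrt hx.1.ne'
  have hd2 : HasDerivAt (fun x => √(1 - x)) (-1 / (2 * √(1 - x))) x :=
    ((hasDerivAt_id' x).const_sub 1).sqrt h1.ne'
  have h := hd1.div hd2 ht.ne'
  refine h.congr_deriv ?_
  have e1 : √x ^ 2 = x := Real.sq_sqrt hx.1.le
  have e2 : √(1 - x) ^ 2 = 1 - x := Real.sq_sqrt h1.le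
  rw [growthDeriv]
  field_simp
  rw [e1, e2]; ring

theorem growthDeriv_nonneg (x : ℝ) : 0 ≤ growthDeriv x := by
  unfold growthDeriv; positivity

theorem continuousOn_growthFun : ContinuousOn growthFun (Ico 0 1) := by
  unfold growthFun
  refine ContinuousOn.div (by fun_prop) (by fun_prop) fun x hx => ?_
  exact (Real.sqrt_pos.2 (by linarith [hx.2])).ne'

theorem growthFun_zero : growthFun 0 = 0 := by simp [growthFun]

theorem intervalIntegrable_growthDeriv {x : ℝ} (hx : x ∈ Ioo (0 : ℝ) 1) :
    IntervalIntegrable growthDeriv volume 0 x := by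
  apply intervalIntegral.intervalIntegrable_deriv_of_nonneg (g := growthFun)
  · rw [uIcc_of_le hx.1.le]
    exact continuousOn_growthFun.mono fun y hy => ⟨hy.1, hy.2.trans_lt hx.2⟩
  · rw [min_eq_left hx.1.le, max_eq_right hx.1.le]
    exact fun y hy => hasDerivAt_growthFun ⟨hy.1, hy.2.trans hx.2⟩
  · exact fun y _ => growthDeriv_nonneg y

theorem integral_growthDeriv {x : ℝ} (hx : x ∈ Ioo (0 : ℝ) 1) :
    ∫ y in (0 : ℝ)..x, growthDeriv y = growthFun x := by
  rw [intervalIntegral.integral_eq_sub_of_hasDerivAt_of_le hx.1.le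
    (continuousOn_growthFun.mono fun y hy => ⟨hy.1, hy.2.trans_lt hx.2⟩)
    (fun y hy => hasDerivAt_growthFun ⟨hy.1, hy.2.trans hx.2⟩)
    (intervalIntegrable_growthDeriv hx), growthFun_zero, sub_zero]

/-- A common bound for `(log x)^k` and `growthFun`, integrable on the unit interval. -/
def envelope (x : ℝ) : ℝ := 1 / √x + 1 / √(1 - x)

theorem intervalIntegrable_envelope : IntervalIntegrable envelope volume 0 1 := by
  have h : IntervalIntegrable (fun x => 1 / (2 * √x) + 1 / (2 * √(1 - x))) volume 0 1 := by
    apply intervalIntegral.intervalIntegrable_deriv_of_nonneg (g := fun x => √x - √(1 - x))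
    · fun_prop
    · rw [min_eq_left zero_le_one, max_eq_right zero_le_one]
      intro x hx
      have hd2 : HasDerivAt (fun x => √(1 - x)) (-1 / (2 * √(1 - x))) x :=
        ((hasDerivAt_id' x).const_sub 1).sqrt (by linarith [hx.2])
      refine ((Real.hasDerivAt_sqrt hx.1.ne').sub hd2).congr_deriv ?_
      ring
    · intro x _; positivity
  have h2 := h.const_mul 2
  refine h2.congr fun x _ => ?_
  unfold envelope
  field_simp

theorem growthFun_le_envelope {x : ℝ} (hx : x ∈ Ioo (0 : ℝ) 1) : growthFun x ≤ envelope x := by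
  have hs1 : √x ≤ 1 := Real.sqrt_le_one.2 hx.2.le
  have : growthFun x ≤ 1 / √(1 - x) := by
    unfold growthFun; gcongr
  have h0 : 0 ≤ 1 / √x := by positivity
  unfold envelope; linarith

theorem abs_log_pow_div_factorial_le {x : ℝ} (hx : x ∈ Ioo (0 : ℝ) 1) (k : ℕ) :
    |Real.log x ^ k / (k.factorial : ℝ)| ≤ 2 ^ k * (1 / √x) := by
  have hl : Real.log x < 0 := Real.log_neg hx.1 hx.2
  have h := Real.pow_div_factorial_le_exp (-Real.log x / 2) (by linarith) k
  have he : Real.exp (-Real.log x / 2) = 1 / √x := by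
    rw [Real.sqrt_eq_rpow, Real.rpow_def_of_pos hx.1, one_div, ← Real.exp_neg]
    congr 1; ring
  rw [he] at h
  rw [abs_div, abs_pow, abs_of_neg hl, Nat.abs_cast]
  calc (-Real.log x) ^ k / (k.factorial : ℝ)
      = 2 ^ k * ((-Real.log x / 2) ^ k / (k.factorial : ℝ)) := by
        rw [div_pow]; field_simp
    _ ≤ _ := by gcongr

theorem hpl_of_forall_eq_zero {m : List ℝ} (h : ∀ z ∈ m, z = 0) (x : ℝ) :
    hpl m x = Real.log x ^ m.length / (m.length.factorial : ℝ) := by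
  cases m with
  | nil => simp [hpl]
  | cons a m => rw [hpl, if_pos h]; simp

theorem hpl_cons_of_not {a : ℝ} {m : List ℝ} (h : ¬ ∀ z ∈ a :: m, z = 0) :
    hpl (a :: m) = fun x => ∫ y in (0 : ℝ)..x, letterFun a y * hpl m y := by
  funext x; rw [hpl, if_neg h]

/-- What the induction on the word provides: continuity and a bound, by a multiple of `1/√x` for
a power of the logarithm and of `growthFun` otherwise. -/
structure HplBounds (m : List ℝ) : Prop where
  cont : ContinuousOn (hpl m) (Ioo 0 1)
  zero : (∀ z ∈ m, z = 0) → ∃ C : ℝ, 0 ≤ C ∧ ∀ x ∈ Ioo (0 : ℝ) 1, |hpl m x| ≤ C * (1 / √x)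
  nonzero : (¬ ∀ z ∈ m, z = 0) →
    ∃ C : ℝ, 0 ≤ C ∧ ∀ x ∈ Ioo (0 : ℝ) 1, |hpl m x| ≤ C * growthFun x

theorem exists_abs_letterFun_mul_hpl_le {a : ℝ} {m : List ℝ} (hm : LettersGeOne (a :: m))
    (hb : HplBounds m) (h : ¬ ∀ z ∈ a :: m, z = 0) :
    ∃ C : ℝ, 0 ≤ C ∧ ∀ x ∈ Ioo (0 : ℝ) 1, |letterFun a x * hpl m x| ≤ C * growthDeriv x := by
  have ha := hm a List.mem_cons_self
  by_cases hz : ∀ z ∈ m, z = 0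
  · have ha0 : a ≠ 0 := by
      rintro rfl
      exact h (by simpa using hz)
    obtain ⟨C, hC, hbd⟩ := hb.zero hz
    refine ⟨2 * C, by positivity, fun x hx => ?_⟩
    have h1 : 0 < 1 - x := by linarith [hx.2]
    have hs : 0 < √x := Real.sqrt_pos.2 hx.1
    have ht : 0 < √(1 - x) := Real.sqrt_pos.2 h1
    have ht1 : √(1 - x) ≤ 1 := Real.sqrt_le_one.2 (by linarith [hx.1])
    have e2 : √(1 - x) ^ 2 = 1 - x := Real.sq_sqrt h1.le
    rw [abs_mul]
    calc |letterFun a x| * |hpl m x| ≤ 1 / (1 - x) * (C * (1 / √x)) :=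
          mul_le_mul (abs_letterFun_le (ha ha0) hx) (hbd x hx) (abs_nonneg _) (by positivity)
      _ ≤ 1 / √(1 - x) ^ 3 * (C * (1 / √x)) := by
          refine mul_le_mul_of_nonneg_right ?_ (by positivity)
          refine one_div_le_one_div_of_le (by positivity) ?_
          calc √(1 - x) ^ 3 ≤ √(1 - x) ^ 2 := pow_le_pow_of_le_one ht.le ht1 (by norm_num)
            _ = 1 - x := e2
      _ = _ := by unfold growthDeriv; field_simp
  · obtain ⟨C, hC, hbd⟩ := hb.nonzero hz
    refine ⟨2 * C, by positivity, fun x hx => ?_⟩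
    have h1 : 0 < 1 - x := by linarith [hx.2]
    have hs : 0 < √x := Real.sqrt_pos.2 hx.1
    have ht : 0 < √(1 - x) := Real.sqrt_pos.2 h1
    have ht1 : √(1 - x) ≤ 1 := Real.sqrt_le_one.2 (by linarith [hx.1])
    have e1 : √x ^ 2 = x := Real.sq_sqrt hx.1.le
    have e2 : √(1 - x) ^ 2 = 1 - x := Real.sq_sqrt h1.le
    have hf : |letterFun a x| ≤ 1 / (x * (1 - x)) := by
      by_cases ha0 : a = 0
      · rw [ha0, letterFun_zero, abs_of_pos (by simpa using hx.1)]
        apply one_div_le_one_div_of_le (by have := hx.1; positivity)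
        nlinarith [hx.1]
      · refine (abs_letterFun_le (ha ha0) hx).trans ?_
        apply one_div_le_one_div_of_le (by have := hx.1; positivity)
        nlinarith [hx.1, hx.2]
    rw [abs_mul]
    have hx0 := hx.1
    calc |letterFun a x| * |hpl m x| ≤ 1 / (x * (1 - x)) * (C * growthFun x) :=
          mul_le_mul hf (hbd x hx) (abs_nonneg _) (by positivity)
      _ = 1 / (√x ^ 2 * √(1 - x) ^ 2) * (C * growthFun x) := by rw [e1, e2]
      _ = _ := by
          unfold growthFun growthDeriv
          field_simp

theorem aestronglyMeasurable_of_continuousOn_Ioo {f : ℝ → ℝ} (hf : ContinuousOn f (Ioo 0 1)) :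
    AEStronglyMeasurable f (volume.restrict (Ioc 0 1)) := by
  rw [← restrict_Ioo_eq_restrict_Ioc]
  exact hf.aestronglyMeasurable measurableSet_Ioo

theorem ae_restrict_Ioc_of_forall_Ioo {p : ℝ → Prop} (h : ∀ x ∈ Ioo (0 : ℝ) 1, p x) :
    ∀ᵐ x ∂(volume.restrict (Ioc (0 : ℝ) 1)), p x := by
  rw [← restrict_Ioo_eq_restrict_Ioc]
  exact (ae_restrict_iff' measurableSet_Ioo).2 (Eventually.of_forall h)

theorem intervalIntegrable_letterFun_mul_hpl {a : ℝ} {m : List ℝ} (hm : LettersGeOne (a :: m))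
    (hb : HplBounds m) (h : ¬ ∀ z ∈ a :: m, z = 0) {x : ℝ} (hx : x ∈ Ioo (0 : ℝ) 1) :
    IntervalIntegrable (fun y => letterFun a y * hpl m y) volume 0 x := by
  obtain ⟨C, -, hbd⟩ := exists_abs_letterFun_mul_hpl_le hm hb h
  refine ((intervalIntegrable_growthDeriv hx).const_mul C).mono_fun' ?_ ?_
  · rw [uIoc_of_le hx.1.le]
    refine ContinuousOn.aestronglyMeasurable ?_ measurableSet_Ioc
    exact ((continuousOn_letterFun (hm a List.mem_cons_self)).mul hb.cont).mono
      fun y hy => ⟨hy.1, hy.2.trans_lt hx.2⟩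
  · rw [uIoc_of_le hx.1.le]
    refine (ae_restrict_iff' measurableSet_Ioc).2 (Eventually.of_forall fun y hy => ?_)
    exact hbd y ⟨hy.1, hy.2.trans_lt hx.2⟩

theorem hasDerivAt_hpl_cons_of_bounds {a : ℝ} {m : List ℝ} (hm : LettersGeOne (a :: m))
    (hb : HplBounds m) {x : ℝ} (hx : x ∈ Ioo (0 : ℝ) 1) :
    HasDerivAt (hpl (a :: m)) (letterFun a x * hpl m x) x := by
  by_cases h : ∀ z ∈ a :: m, z = 0
  · have h' : ∀ z ∈ m, z = 0 := fun z hz => h z (List.mem_cons_of_mem _ hz)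
    have ha : a = 0 := h a List.mem_cons_self
    rw [funext (hpl_of_forall_eq_zero h), hpl_of_forall_eq_zero h', ha, letterFun_zero]
    refine (((Real.hasDerivAt_log hx.1.ne').pow (m.length + 1)).div_const _).congr_deriv ?_
    rw [List.length_cons, Nat.factorial_succ]
    have : ((m.length : ℝ) + 1) ≠ 0 := by positivity
    have := hx.1.ne'
    push_cast
    field_simp
  · rw [hpl_cons_of_not h]
    have hc : ContinuousOn (fun y => letterFun a y * hpl m y) (Ioo 0 1) :=
      (continuousOn_letterFun (hm a List.mem_cons_self)).mul hb.cont
    exact intervalIntegral.integral_hasDerivAt_right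
      (intervalIntegrable_letterFun_mul_hpl hm hb h hx)
      (hc.stronglyMeasurableAtFilter isOpen_Ioo x hx) (hc.continuousAt (isOpen_Ioo.mem_nhds hx))

theorem hplBounds {m : List ℝ} (hm : LettersGeOne m) : HplBounds m := by
  induction m with
  | nil =>
    have h0 : hpl [] = fun _ => 1 := funext fun x => by simp [hpl]
    refine ⟨by rw [h0]; exact continuousOn_const, fun _ => ⟨1, zero_le_one, fun x hx => ?_⟩,
      fun h => absurd (by simp) h⟩
    have := abs_log_pow_div_factorial_le hx 0
    rw [h0]
    simpa using this
  | cons a m ih =>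
    have hb := ih hm.of_cons
    refine ⟨fun x hx => (hasDerivAt_hpl_cons_of_bounds hm hb hx).continuousAt.continuousWithinAt,
      fun hz => ⟨2 ^ (m.length + 1), by positivity, fun x hx => ?_⟩, fun hz => ?_⟩
    · rw [hpl_of_forall_eq_zero hz]
      exact abs_log_pow_div_factorial_le hx _
    · obtain ⟨C, hC, hbd⟩ := exists_abs_letterFun_mul_hpl_le hm hb hz
      refine ⟨C, hC, fun x hx => ?_⟩
      rw [hpl_cons_of_not hz, ← integral_growthDeriv hx, ← intervalIntegral.integral_const_mul]
      rw [← Real.norm_eq_abs]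
      refine intervalIntegral.norm_integral_le_of_norm_le hx.1.le
        (Eventually.of_forall fun y hy => ?_) ((intervalIntegrable_growthDeriv hx).const_mul C)
      exact hbd y ⟨hy.1, hy.2.trans_lt hx.2⟩

theorem hasDerivAt_hpl_cons {a : ℝ} {m : List ℝ} (hm : LettersGeOne (a :: m)) {x : ℝ}
    (hx : x ∈ Ioo (0 : ℝ) 1) : HasDerivAt (hpl (a :: m)) (letterFun a x * hpl m x) x :=
  hasDerivAt_hpl_cons_of_bounds hm (hplBounds hm.of_cons) hx

theorem exists_abs_hpl_le_envelope {m : List ℝ} (hm : LettersGeOne m) :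
    ∃ C : ℝ, 0 ≤ C ∧ ∀ x ∈ Ioo (0 : ℝ) 1, |hpl m x| ≤ C * envelope x := by
  by_cases hz : ∀ z ∈ m, z = 0
  · obtain ⟨C, hC, h⟩ := (hplBounds hm).zero hz
    refine ⟨C, hC, fun x hx => (h x hx).trans ?_⟩
    gcongr
    unfold envelope
    have : 0 ≤ 1 / √(1 - x) := by positivity
    linarith
  · obtain ⟨C, hC, h⟩ := (hplBounds hm).nonzero hz
    exact ⟨C, hC, fun x hx => (h x hx).trans (by gcongr; exact growthFun_le_envelope hx)⟩

theorem intervalIntegrable_mul_hpl {m : List ℝ} (hm : LettersGeOne m) {k : ℝ → ℝ}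
    (hk : Measurable k) {K : ℝ} (hK : ∀ x ∈ Ioo (0 : ℝ) 1, |k x| ≤ K) :
    IntervalIntegrable (fun x => k x * hpl m x) volume 0 1 := by
  obtain ⟨C, hC, hbd⟩ := exists_abs_hpl_le_envelope hm
  refine (intervalIntegrable_envelope.const_mul (K * C)).mono_fun' ?_ ?_
  · rw [uIoc_of_le zero_le_one]
    exact hk.aestronglyMeasurable.mul (aestronglyMeasurable_of_continuousOn_Ioo (hplBounds hm).cont)
  · rw [uIoc_of_le zero_le_one]
    refine ae_restrict_Ioc_of_forall_Ioo fun x hx => ?_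
    have h1 := hK x hx
    have h2 := hbd x hx
    simp only [Real.norm_eq_abs]
    rw [abs_mul, mul_assoc]
    exact mul_le_mul h1 h2 (abs_nonneg _) ((abs_nonneg _).trans h1)

theorem intervalIntegrable_pow_mul_hpl {m : List ℝ} (hm : LettersGeOne m) (n : ℕ) :
    IntervalIntegrable (fun x => x ^ n * hpl m x) volume 0 1 := by
  refine intervalIntegrable_mul_hpl hm (K := 1) (by fun_prop) fun x hx => ?_
  rw [abs_pow, abs_of_pos hx.1]
  exact pow_le_one₀ hx.1.le hx.2.le

/-! ### Boundary behaviour and integration by parts -/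

theorem exists_letterFun_le {a : ℝ} (h0 : a ≠ 0) (h1 : a ≠ 1) (ha : 1 ≤ |a|) :
    ∃ K : ℝ, 0 ≤ K ∧ ∀ x ∈ Ioo (0 : ℝ) 1, |letterFun a x| ≤ K := by
  rcases lt_or_gt_of_ne h0 with hneg | hpos
  · refine ⟨1, zero_le_one, fun x hx => ?_⟩
    rw [letterFun, if_neg h0, Real.sign_of_neg hneg]
    have : 1 ≤ |a| - -1 * x := by linarith [hx.1]
    rw [abs_of_pos (by positivity), div_le_one (by linarith)]
    exact this
  · rw [abs_of_pos hpos] at ha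
    have hlt : 0 < a - 1 := sub_pos.2 (lt_of_le_of_ne ha (Ne.symm h1))
    refine ⟨1 / (a - 1), by positivity, fun x hx => ?_⟩
    rw [letterFun, if_neg h0, Real.sign_of_pos hpos, abs_of_pos hpos]
    have : a - 1 ≤ a - 1 * x := by linarith [hx.2]
    rw [abs_of_pos (by have := hlt.trans_le this; positivity)]
    exact one_div_le_one_div_of_le hlt this

/-- Away from the letter `1` the integrand of the iterated integral is integrable up to `1`. -/
theorem intervalIntegrable_letterFun_mul_hpl_one {a : ℝ} {m : List ℝ}
    (hm : LettersGeOne (a :: m)) (ha1 : a ≠ 1) (h : ¬ ∀ z ∈ a :: m, z = 0) :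
    IntervalIntegrable (fun y => letterFun a y * hpl m y) volume 0 1 := by
  by_cases ha0 : a = 0
  · subst ha0
    have hz : ¬ ∀ z ∈ m, z = 0 := by simpa using h
    obtain ⟨C, hC, hbd⟩ := (hplBounds hm.of_cons).nonzero hz
    refine (intervalIntegrable_envelope.const_mul C).mono_fun' ?_ ?_
    · rw [uIoc_of_le zero_le_one]
      exact (measurable_letterFun 0).aestronglyMeasurable.mul
        (aestronglyMeasurable_of_continuousOn_Ioo (hplBounds hm.of_cons).cont)
    · rw [uIoc_of_le zero_le_one]
      refine ae_restrict_Ioc_of_forall_Ioo fun x hx => ?_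
      have h1 : 0 < 1 - x := by linarith [hx.2]
      have hs : 0 < √x := Real.sqrt_pos.2 hx.1
      have ht : 0 < √(1 - x) := Real.sqrt_pos.2 h1
      have ht1 : √(1 - x) ≤ 1 := Real.sqrt_le_one.2 (by linarith [hx.1])
      have hs1 : √x ≤ 1 := Real.sqrt_le_one.2 hx.2.le
      have e1 : √x ^ 2 = x := Real.sq_sqrt hx.1.le
      have e2 : √(1 - x) ^ 2 = 1 - x := Real.sq_sqrt h1.le
      have hx0 := hx.1
      simp only [Real.norm_eq_abs]
      rw [abs_mul, letterFun_zero, abs_of_pos (by positivity)]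
      calc 1 / x * |hpl m x| ≤ 1 / x * (C * growthFun x) := by
            gcongr; exact hbd x hx
        _ = C * (1 / x * growthFun x) := by ring
        _ ≤ C * envelope x := by
            gcongr
            -- `1 / (√x √(1-x)) = √(1-x) / √x + √x / √(1-x)`
            have : 1 / x * growthFun x = √(1 - x) / √x + √x / √(1 - x) := by
              unfold growthFun
              nth_rw 1 [← e1]
              field_simp
              rw [e1, e2]; ring
            rw [this]
            unfold envelope
            gcongr
  · obtain ⟨K, -, hK⟩ := exists_letterFun_le ha0 ha1 (hm a List.mem_cons_self ha0)
    exact intervalIntegrable_mul_hpl hm.of_cons (measurable_letterFun a) hK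

theorem exists_tendsto_hpl_one {a : ℝ} {m : List ℝ} (hm : LettersGeOne (a :: m)) (ha1 : a ≠ 1) :
    ∃ L : ℝ, Tendsto (hpl (a :: m)) (𝓝[<] 1) (𝓝 L) := by
  by_cases h : ∀ z ∈ a :: m, z = 0
  · rw [funext (hpl_of_forall_eq_zero h)]
    have : ContinuousAt (fun x => Real.log x ^ (a :: m).length /
        ((a :: m).length.factorial : ℝ)) 1 :=
      ((Real.continuousAt_log one_ne_zero).pow _).div_const _
    exact ⟨_, this.tendsto.mono_left nhdsWithin_le_nhds⟩
  · rw [hpl_cons_of_not h]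
    have hi := intervalIntegrable_letterFun_mul_hpl_one hm ha1 h
    rw [intervalIntegrable_iff_integrableOn_Icc_of_le zero_le_one] at hi
    have hc := intervalIntegral.continuousOn_primitive_interval (a := (0 : ℝ)) (b := 1)
      (f := fun y => letterFun a y * hpl m y) (by rwa [uIcc_of_le zero_le_one])
    rw [uIcc_of_le zero_le_one] at hc
    have h1 := (hc 1 (right_mem_Icc.2 zero_le_one)).tendsto
    refine ⟨_, h1.mono_left ?_⟩
    rw [← nhdsWithin_Ioo_eq_nhdsLT zero_lt_one]
    exact nhdsWithin_mono _ Ioo_subset_Icc_self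

theorem tendsto_pow_mul_hpl_zero {m : List ℝ} (hm : LettersGeOne m) (n : ℕ) :
    Tendsto (fun x => x ^ (n + 1) * hpl m x) (𝓝[>] 0) (𝓝 0) := by
  obtain ⟨C, hC, hbd⟩ := exists_abs_hpl_le_envelope hm
  have hlim : Tendsto (fun x => C * (√x + x / √(1 - x))) (𝓝[>] 0) (𝓝 0) := by
    have : ContinuousAt (fun x => C * (√x + x / √(1 - x))) 0 := by
      refine ContinuousAt.mul continuousAt_const (ContinuousAt.add (by fun_prop) ?_)
      exact ContinuousAt.div (by fun_prop) (by fun_prop) (by simp)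
    have h := this.tendsto
    simp only [Real.sqrt_zero, zero_div, add_zero, mul_zero] at h
    exact h.mono_left nhdsWithin_le_nhds
  refine squeeze_zero_norm' ?_ hlim
  filter_upwards [Ioo_mem_nhdsGT (zero_lt_one' ℝ)] with x hx
  have h1 := hbd x hx
  have hs : 0 < √x := Real.sqrt_pos.2 hx.1
  have e1 : √x * √x = x := Real.mul_self_sqrt hx.1.le
  rw [Real.norm_eq_abs, abs_mul, abs_pow, abs_of_pos hx.1]
  calc x ^ (n + 1) * |hpl m x| ≤ x * (C * envelope x) := by
        gcongr
        · exact hx.1.le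
        · exact pow_le_of_le_one hx.1.le hx.2.le (by omega)
    _ = _ := by
        unfold envelope
        have : x * (1 / √x) = √x := by
          nth_rw 1 [← e1]; field_simp
        linear_combination C * this

theorem intervalIntegrable_pow_mul_letterFun_mul_hpl {a : ℝ} {m : List ℝ}
    (hm : LettersGeOne (a :: m)) (ha1 : a ≠ 1) (n : ℕ) :
    IntervalIntegrable (fun x => x ^ (n + 1) * (letterFun a x * hpl m x)) volume 0 1 := by
  by_cases ha0 : a = 0
  · have := intervalIntegrable_pow_mul_hpl hm.of_cons n
    refine this.congr fun x hx => ?_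
    rw [uIoc_of_le zero_le_one] at hx
    have := hx.1.ne'
    simp only [ha0, letterFun_zero, pow_succ]
    field_simp
  · obtain ⟨K, hK0, hK⟩ := exists_letterFun_le ha0 ha1 (hm a List.mem_cons_self ha0)
    have h := intervalIntegrable_mul_hpl (k := fun x => x ^ (n + 1) * letterFun a x) hm.of_cons
      ((measurable_id.pow_const _).mul (measurable_letterFun a)) (K := K) fun x hx => by
        rw [abs_mul, abs_pow, abs_of_pos hx.1]
        have h1 : x ^ (n + 1) ≤ 1 := pow_le_one₀ hx.1.le hx.2.le
        calc _ ≤ 1 * K := mul_le_mul h1 (hK x hx) (abs_nonneg _) zero_le_one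
          _ = K := one_mul K
    exact h.congr fun x _ => by simp only [mul_assoc]

theorem exists_integral_pow_mul_hpl_cons {a : ℝ} {m : List ℝ}
    (hm : LettersGeOne (a :: m)) (ha1 : a ≠ 1) :
    ∃ L : ℝ, ∀ n : ℕ, ∫ x in (0 : ℝ)..1, x ^ n * hpl (a :: m) x =
      (L - ∫ x in (0 : ℝ)..1, x ^ (n + 1) * (letterFun a x * hpl m x)) / ((n : ℝ) + 1) := by
  obtain ⟨L, hL⟩ := exists_tendsto_hpl_one hm ha1
  refine ⟨L, fun n => ?_⟩
  have hn : (n : ℝ) + 1 ≠ 0 := by positivity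
  have i1 := (intervalIntegrable_pow_mul_hpl hm n).const_mul ((n : ℝ) + 1)
  have i2 := intervalIntegrable_pow_mul_letterFun_mul_hpl hm ha1 n
  have h := intervalIntegral.integral_eq_sub_of_hasDerivAt_of_tendsto (zero_lt_one' ℝ)
    (f := fun x => x ^ (n + 1) * hpl (a :: m) x) (fun x hx => by
      refine ((hasDerivAt_pow (n + 1) x).mul (hasDerivAt_hpl_cons hm hx)).congr_deriv ?_
      rw [Nat.add_sub_cancel, mul_assoc, Nat.cast_add, Nat.cast_one])
    (i1.add i2) (tendsto_pow_mul_hpl_zero hm n)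
    (by
      have : Tendsto (fun x : ℝ => x ^ (n + 1)) (𝓝[<] 1) (𝓝 (1 ^ (n + 1))) :=
        ((continuous_pow (n + 1)).tendsto 1).mono_left nhdsWithin_le_nhds
      simpa using this.mul hL)
  rw [intervalIntegral.integral_add i1 i2, intervalIntegral.integral_const_mul] at h
  rw [eq_div_iff hn]
  linear_combination h

theorem abs_pow_sub_one_le {x : ℝ} (hx : x ∈ Ioo (0 : ℝ) 1) (n : ℕ) :
    |x ^ n - 1| ≤ n * (1 - x) := by
  have h1 : x ^ n ≤ 1 := pow_le_one₀ hx.1.le hx.2.le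
  have h2 := one_add_mul_le_pow (a := x - 1) (by linarith [hx.1]) n
  rw [abs_of_nonpos (by linarith)]
  have : 1 + (x - 1) = x := by ring
  rw [this] at h2
  linarith

theorem letterFun_one_eq (x : ℝ) : letterFun 1 x = 1 / (1 - x) := by
  simp [letterFun]

/-- For the leading letter `1` the primitive `(x^(n+1) - 1)/(n+1)` compensates the singularity
at `1`. -/
theorem integral_pow_mul_hpl_one_cons {m : List ℝ} (hm : LettersGeOne (1 :: m)) (n : ℕ) :
    ∫ x in (0 : ℝ)..1, x ^ n * hpl (1 :: m) x =
      (-∫ x in (0 : ℝ)..1, (x ^ (n + 1) - 1) * (letterFun 1 x * hpl m x)) / ((n : ℝ) + 1) := by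
  have hn : (n : ℝ) + 1 ≠ 0 := by positivity
  have hz : ¬ ∀ z ∈ (1 : ℝ) :: m, z = 0 := fun h => one_ne_zero (h 1 List.mem_cons_self)
  obtain ⟨C, hC, hbd⟩ := (hplBounds hm).nonzero hz
  have i1 := (intervalIntegrable_pow_mul_hpl hm n).const_mul ((n : ℝ) + 1)
  have i2 : IntervalIntegrable (fun x => (x ^ (n + 1) - 1) * (letterFun 1 x * hpl m x))
      volume 0 1 := by
    have h := intervalIntegrable_mul_hpl (k := fun x => (x ^ (n + 1) - 1) * letterFun 1 x)
      hm.of_cons (((measurable_id.pow_const _).sub_const 1).mul (measurable_letterFun 1))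
      (K := ((n + 1 : ℕ) : ℝ)) fun x hx => by
        have h1 : 0 < 1 - x := by linarith [hx.2]
        rw [abs_mul, letterFun_one_eq, abs_of_pos (a := 1 / (1 - x)) (by positivity),
          mul_one_div, div_le_iff₀ h1]
        exact abs_pow_sub_one_le hx _
    exact h.congr fun x _ => by simp only [mul_assoc]
  have hlim0 : Tendsto (fun x => (x ^ (n + 1) - 1) * hpl (1 :: m) x) (𝓝[>] 0) (𝓝 0) := by
    have hc : Tendsto (fun x => C * growthFun x) (𝓝[>] 0) (𝓝 0) := by
      have h1 := (continuousOn_growthFun 0 ⟨le_rfl, zero_lt_one⟩).tendsto.const_mul C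
      rw [growthFun_zero, mul_zero] at h1
      refine h1.mono_left ?_
      rw [← nhdsWithin_Ioo_eq_nhdsGT (zero_lt_one' ℝ)]
      exact nhdsWithin_mono _ fun y hy => ⟨hy.1.le, hy.2⟩
    refine squeeze_zero_norm' ?_ hc
    filter_upwards [Ioo_mem_nhdsGT (zero_lt_one' ℝ)] with x hx
    have h1 : x ^ (n + 1) ≤ 1 := pow_le_one₀ hx.1.le hx.2.le
    have h2 : 0 ≤ x ^ (n + 1) := pow_nonneg hx.1.le _
    rw [Real.norm_eq_abs, abs_mul]
    calc _ ≤ 1 * |hpl (1 :: m) x| := by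
          gcongr
          rw [abs_le]; constructor <;> linarith
      _ ≤ _ := by rw [one_mul]; exact hbd x hx
  have hlim1 : Tendsto (fun x => (x ^ (n + 1) - 1) * hpl (1 :: m) x) (𝓝[<] 1) (𝓝 0) := by
    have hc : Tendsto (fun x => ((n + 1 : ℕ) : ℝ) * C * (√x * √(1 - x))) (𝓝[<] 1) (𝓝 0) := by
      have h1 : Continuous fun x : ℝ => ((n + 1 : ℕ) : ℝ) * C * (√x * √(1 - x)) := by fun_prop
      have h2 := h1.tendsto 1
      simp only [sub_self, Real.sqrt_zero, mul_zero] at h2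
      exact h2.mono_left nhdsWithin_le_nhds
    refine squeeze_zero_norm' ?_ hc
    filter_upwards [Ioo_mem_nhdsLT (zero_lt_one' ℝ)] with x hx
    have h1 : 0 < 1 - x := by linarith [hx.2]
    have ht : 0 < √(1 - x) := Real.sqrt_pos.2 h1
    have e2 : √(1 - x) * √(1 - x) = 1 - x := Real.mul_self_sqrt h1.le
    rw [Real.norm_eq_abs, abs_mul]
    calc _ ≤ (((n + 1 : ℕ) : ℝ) * (1 - x)) * (C * growthFun x) := by
          gcongr
          · exact abs_pow_sub_one_le hx _
          · exact hbd x hx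
      _ = _ := by
          unfold growthFun
          nth_rw 1 [← e2]
          field_simp
  have h := intervalIntegral.integral_eq_sub_of_hasDerivAt_of_tendsto (zero_lt_one' ℝ)
    (f := fun x => (x ^ (n + 1) - 1) * hpl (1 :: m) x) (fun x hx => by
      refine (((hasDerivAt_pow (n + 1) x).sub_const 1).mul
        (hasDerivAt_hpl_cons hm hx)).congr_deriv ?_
      rw [Nat.add_sub_cancel, mul_assoc, Nat.cast_add, Nat.cast_one])
    (i1.add i2) hlim0 hlim1
  rw [intervalIntegral.integral_add i1 i2, intervalIntegral.integral_const_mul] at h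
  rw [eq_div_iff hn]
  linear_combination h

/-! ### The Mellin transform as a sum over moments -/

theorem add_mul_ne_zero_of_ne_pole {c d x : ℝ} (hd : d ≠ 0) (hx : x ≠ pole c d) : c + d * x ≠ 0 := by
  intro h
  apply hx
  rw [pole, eq_div_iff hd]; linarith

theorem add_mul_eq_pole {c d : ℝ} (hd : d ≠ 0) (x : ℝ) : c + d * x = d * (x - pole c d) := by
  rw [pole]; field_simp; ring

theorem pole_ne_zero {c d : ℝ} (hc : c ≠ 0) (hd : d ≠ 0) : pole c d ≠ 0 :=
  div_ne_zero (neg_ne_zero.2 hc) hd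

theorem prefactor_ne_zero {c d : ℝ} (hc : c ≠ 0) (hd : d ≠ 0) (n : ℕ) : prefactor c d n ≠ 0 := by
  unfold prefactor
  split_ifs
  · exact one_ne_zero
  · exact pow_ne_zero _ (pole_ne_zero hc hd)

theorem measurable_mellinKernel_div (c d : ℝ) (n : ℕ) :
    Measurable fun x => mellinKernel c d n x / (c + d * x) := by
  unfold mellinKernel
  split_ifs <;> fun_prop

/-- The weight of the transform is bounded: a pole in `(0,1]` is cancelled by a zero of the
kernel. -/
theorem exists_abs_mellinKernel_div_le {c d : ℝ} (hc : c ≠ 0) (hd : d ≠ 0) (n : ℕ) :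
    ∃ K : ℝ, ∀ x ∈ Ioo (0 : ℝ) 1, |mellinKernel c d n x / (c + d * x)| ≤ K := by
  by_cases hs : 0 < pole c d ∧ pole c d ≤ 1
  · set s := pole c d with hsdef
    obtain ⟨K, hK⟩ := isCompact_Icc.exists_bound_of_continuousOn (s := Icc (0 : ℝ) 1)
      (f := fun x => (∑ j ∈ Finset.range n, (x / s) ^ j) / (s * d)) (by fun_prop)
    refine ⟨K, fun x hx => ?_⟩
    have hKx := hK x ⟨hx.1.le, hx.2.le⟩
    by_cases hxs : x = s
    · rw [add_mul_eq_pole hd, ← hsdef, hxs, sub_self, mul_zero, div_zero, abs_zero]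
      exact (norm_nonneg _).trans hKx
    · refine le_of_eq_of_le ?_ hKx
      rw [Real.norm_eq_abs, mellinKernel, if_pos hs, ← hsdef, ← geom_sum_mul,
        add_mul_eq_pole hd, ← hsdef]
      congr 1
      have h1 : x - s ≠ 0 := sub_ne_zero.2 hxs
      have h2 : s ≠ 0 := hs.1.ne'
      have h3 : x / s - 1 = (x - s) / s := by field_simp
      rw [h3, div_eq_div_iff (mul_ne_zero hd h1) (mul_ne_zero h2 hd)]
      field_simp
  · obtain ⟨K, hK⟩ := isCompact_Icc.exists_bound_of_continuousOn (s := Icc (0 : ℝ) 1)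
      (f := fun x => x ^ n / (c + d * x)) (by
        refine ContinuousOn.div (by fun_prop) (by fun_prop) fun x hx h0 => ?_
        by_cases hx0 : x = 0
        · rw [hx0] at h0; exact hc (by linarith)
        · refine hs ?_
          have : pole c d = x := by
            rw [pole, div_eq_iff hd]; linarith
          rw [this]
          exact ⟨lt_of_le_of_ne hx.1 (Ne.symm hx0), hx.2⟩)
    refine ⟨K, fun x hx => ?_⟩
    rw [mellinKernel, if_neg hs]
    exact hK x ⟨hx.1.le, hx.2.le⟩

theorem intervalIntegrable_mellinIntegrand {m : List ℝ} (hm : LettersGeOne m) {c d : ℝ}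
    (hc : c ≠ 0) (hd : d ≠ 0) (n : ℕ) :
    IntervalIntegrable (mellinIntegrand (hpl m) c d n) volume 0 1 := by
  obtain ⟨K, hK⟩ := exists_abs_mellinKernel_div_le hc hd n
  refine (intervalIntegrable_mul_hpl hm (measurable_mellinKernel_div c d n) hK).congr fun x _ => ?_
  simp only [mellinIntegrand]
  ring

/-- The moment `∫₀¹ x^(j-1) H_m(x) dx`, used for `j ≥ 1`. -/
def moment (m : List ℝ) (j : ℕ) : ℝ := ∫ x in (0 : ℝ)..1, x ^ (j - 1) * hpl m x

theorem prefactor_zero (c d : ℝ) : prefactor c d 0 = 1 := by simp [prefactor]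

/-- The recurrence `M(n+1)/ρ(n+1) - M(n)/ρ(n) = d s^{-(n+1)} ∫₀¹ x^n H_m(x) dx`, where `s` is the
pole: the difference of the kernels cancels the denominator. -/
theorem mellinTransform_succ {m : List ℝ} (hm : LettersGeOne m) {c d : ℝ}
    (hc : c ≠ 0) (hd : d = 1 ∨ d = -1) (n : ℕ) :
    mellinTransform (hpl m) c d (n + 1) / prefactor c d (n + 1) =
      mellinTransform (hpl m) c d n / prefactor c d n +
        d * ((pole c d)⁻¹ ^ (n + 1) * moment m (n + 1)) := by
  have hd0 : d ≠ 0 := by rcases hd with rfl | rfl <;> norm_num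
  have hdd : d * d = 1 := by rcases hd with rfl | rfl <;> norm_num
  have hs0 := pole_ne_zero hc hd0
  have h1 := intervalIntegrable_mellinIntegrand hm hc hd0 (n + 1)
  have h2 := intervalIntegrable_mellinIntegrand hm hc hd0 n
  have hae : ∀ᵐ x ∂volume, x ∈ uIoc (0 : ℝ) 1 →
      mellinIntegrand (hpl m) c d (n + 1) x / prefactor c d (n + 1) -
        mellinIntegrand (hpl m) c d n x / prefactor c d n =
      d * (pole c d)⁻¹ ^ (n + 1) * (x ^ n * hpl m x) := by
    have hne : ∀ᵐ x ∂(volume : Measure ℝ), x ≠ pole c d := by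
      simp [ae_iff, measure_singleton]
    filter_upwards [hne] with x hx _
    have hcx := add_mul_ne_zero_of_ne_pole hd0 hx
    have hxs : x - pole c d ≠ 0 := sub_ne_zero.2 hx
    have hker : mellinKernel c d (n + 1) x / prefactor c d (n + 1) -
        mellinKernel c d n x / prefactor c d n =
        (pole c d)⁻¹ ^ (n + 1) * x ^ n * (x - pole c d) := by
      unfold mellinKernel prefactor
      split_ifs with h
      · rw [div_one, div_one, div_pow, div_pow, inv_pow]
        field_simp
        ring
      · rw [inv_pow]
        field_simp
        ring
    have : ∀ k, mellinIntegrand (hpl m) c d k x / prefactor c d k =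
        mellinKernel c d k x / prefactor c d k * (hpl m x / (c + d * x)) := by
      intro k; simp only [mellinIntegrand]; ring
    rw [this, this, ← sub_mul, hker, add_mul_eq_pole hd0]
    field_simp
    linear_combination (-(x ^ n * hpl m x)) * hdd
  have hint := intervalIntegral.integral_congr_ae hae
  rw [intervalIntegral.integral_sub (h1.div_const _) (h2.div_const _),
    intervalIntegral.integral_div, intervalIntegral.integral_div,
    intervalIntegral.integral_const_mul] at hint
  rw [moment, Nat.add_sub_cancel, mellinTransform, mellinTransform]
  linear_combination hint

theorem mellinTransform_eq_sum_moment {m : List ℝ} (hm : LettersGeOne m) {c d : ℝ}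
    (hc : c ≠ 0) (hd : d = 1 ∨ d = -1) (n : ℕ) :
    mellinTransform (hpl m) c d n = prefactor c d n * (mellinTransform (hpl m) c d 0 +
      d * ∑ j ∈ Finset.Icc 1 n, (pole c d)⁻¹ ^ j * moment m j) := by
  have hd0 : d ≠ 0 := by rcases hd with rfl | rfl <;> norm_num
  suffices mellinTransform (hpl m) c d n / prefactor c d n = mellinTransform (hpl m) c d 0 +
      d * ∑ j ∈ Finset.Icc 1 n, (pole c d)⁻¹ ^ j * moment m j by
    rw [← this, mul_div_cancel₀ _ (prefactor_ne_zero hc hd0 n)]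
  induction n with
  | zero => simp [prefactor_zero]
  | succ n ih =>
    rw [mellinTransform_succ hm hc hd, ih, Finset.sum_Icc_succ_top (by omega)]
    ring

theorem exists_moment_zero_cons {m : List ℝ} (hm : LettersGeOne (0 :: m)) :
    ∃ L : ℝ, ∀ j : ℕ, 1 ≤ j → moment (0 :: m) j = (L - moment m j) / j := by
  obtain ⟨L, hL⟩ := exists_integral_pow_mul_hpl_cons hm zero_ne_one
  refine ⟨L, fun j hj => ?_⟩
  obtain ⟨n, rfl⟩ := Nat.exists_eq_add_of_le' hj
  rw [moment, Nat.add_sub_cancel, hL, moment, Nat.add_sub_cancel]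
  push_cast
  congr 2
  refine intervalIntegral.integral_congr_ae (Eventually.of_forall fun x hx => ?_)
  rw [uIoc_of_le zero_le_one] at hx
  have := hx.1.ne'
  rw [letterFun_zero, pow_succ]
  field_simp

theorem pole_abs_neg_sign {a : ℝ} (ha : a ≠ 0) : pole |a| (-Real.sign a) = a := by
  rcases lt_or_gt_of_ne ha with h | h
  · rw [pole, Real.sign_of_neg h, abs_of_neg h]; simp
  · rw [pole, Real.sign_of_pos h, abs_of_pos h]; simp

theorem neg_sign_eq_one_or {a : ℝ} (ha : a ≠ 0) : -Real.sign a = 1 ∨ -Real.sign a = -1 := by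
  rcases lt_or_gt_of_ne ha with h | h
  · rw [Real.sign_of_neg h]; simp
  · rw [Real.sign_of_pos h]; simp

/-- Integration by parts: `∫₀¹ x^(j-1) H_{a,m}(x) dx = (L - M(H_m(x)/(|a| - sign(a) x))(j)) / j`. -/
theorem exists_moment_cons {a : ℝ} {m : List ℝ} (hm : LettersGeOne (a :: m)) (ha : a ≠ 0) :
    ∃ L : ℝ, ∀ j : ℕ, 1 ≤ j → moment (a :: m) j =
      (L - mellinTransform (hpl m) |a| (-Real.sign a) j) / j := by
  have hint : ∀ j x, mellinIntegrand (hpl m) |a| (-Real.sign a) j x =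
      mellinKernel |a| (-Real.sign a) j x * (letterFun a x * hpl m x) := by
    intro j x
    rw [mellinIntegrand, letterFun, if_neg ha, neg_mul, ← sub_eq_add_neg]
    ring
  by_cases ha1 : a = 1
  · refine ⟨0, fun j hj => ?_⟩
    obtain ⟨n, rfl⟩ := Nat.exists_eq_add_of_le' hj
    have hp : pole |a| (-Real.sign a) = 1 := by rw [pole_abs_neg_sign ha, ha1]
    rw [mellinTransform]
    simp only [hint, mellinKernel, hp]
    subst ha1
    rw [moment, Nat.add_sub_cancel, integral_pow_mul_hpl_one_cons hm]
    simp
  · obtain ⟨L, hL⟩ := exists_integral_pow_mul_hpl_cons hm ha1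
    refine ⟨L, fun j hj => ?_⟩
    obtain ⟨n, rfl⟩ := Nat.exists_eq_add_of_le' hj
    have hp : ¬ (0 < pole |a| (-Real.sign a) ∧ pole |a| (-Real.sign a) ≤ 1) := by
      rw [pole_abs_neg_sign ha]
      rintro ⟨h1, h2⟩
      have := hm a List.mem_cons_self ha
      rw [abs_of_pos h1] at this
      exact ha1 (le_antisymm h2 this)
    rw [mellinTransform]
    simp only [hint, mellinKernel, if_neg hp]
    rw [moment, Nat.add_sub_cancel, hL]
    push_cast
    rfl

theorem prefactor_abs_neg_sign {a : ℝ} (ha : a ≠ 0) (ha1 : 1 ≤ |a|) (n : ℕ) :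
    prefactor |a| (-Real.sign a) n = a ^ n := by
  rw [prefactor, pole_abs_neg_sign ha]
  split_ifs with h
  · have : a = 1 := le_antisymm h.2 (by rwa [abs_of_pos h.1] at ha1)
    rw [this, one_pow]
  · rfl

/-! ### The words attached to a polylogarithm -/

/-- The summand `b^i / i^a · S_v(i)` of the sum with index `(a,b) :: v`. -/
def sTerm : SWord → ℕ → ℝ
  | [], _ => 0
  | p :: v, i => p.2 ^ i / (i : ℝ) ^ p.1 * sSum v i

/-- Multiply the first `b` by `r`. -/
def scaleHead (r : ℝ) : SWord → SWord
  | [] => []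
  | p :: v => (p.1, r * p.2) :: v

/-- Raise the first exponent by one. -/
def bumpHead : SWord → SWord
  | [] => []
  | p :: v => (p.1 + 1, p.2) :: v

open Classical in
/-- The index of the leading term in the expansion of `∫₀¹ x^(i-1) H_m(x) dx`. -/
def topWord : List ℝ → SWord
  | [] => [(1, 1)]
  | a :: m => if a = 0 then bumpHead (topWord m) else (1, a) :: scaleHead a⁻¹ (topWord m)

/-- The first nonzero letter of a word, or `1` if there is none. -/
def leadLetter (m : List ℝ) : ℝ := (nonzeroLetters m).headD 1

theorem nonzeroLetters_zero_cons (m : List ℝ) : nonzeroLetters (0 :: m) = nonzeroLetters m := by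
  simp [nonzeroLetters]

theorem nonzeroLetters_cons {a : ℝ} (ha : a ≠ 0) (m : List ℝ) :
    nonzeroLetters (a :: m) = a :: nonzeroLetters m := by
  simp [nonzeroLetters, ha]

theorem leadLetter_zero_cons (m : List ℝ) : leadLetter (0 :: m) = leadLetter m := by
  rw [leadLetter, nonzeroLetters_zero_cons, leadLetter]

theorem leadLetter_cons {a : ℝ} (ha : a ≠ 0) (m : List ℝ) : leadLetter (a :: m) = a := by
  rw [leadLetter, nonzeroLetters_cons ha, List.headD_cons]

theorem isHBar_nil : IsHBar [] := by simp [IsHBar, nonzeroLetters]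

theorem isHBar_zero_cons (m : List ℝ) : IsHBar (0 :: m) ↔ IsHBar m := by
  rw [IsHBar, nonzeroLetters_zero_cons, IsHBar]

theorem abs_div_le_one_iff {u v : ℝ} (hu : u ≠ 0) : |v / u| ≤ 1 ↔ |v| ≤ |u| := by
  rw [abs_div, div_le_one (abs_pos.2 hu)]

theorem isHBar_cons {a : ℝ} (ha : a ≠ 0) (m : List ℝ) :
    IsHBar (a :: m) ↔ IsHBar m ∧ |leadLetter m| ≤ |a| := by
  rw [IsHBar, IsHBar, leadLetter, nonzeroLetters_cons ha]
  cases nonzeroLetters m with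
  | nil => simpa using inv_le_one₀ (abs_pos.2 ha)
  | cons b l =>
    rw [List.isChain_cons_cons, List.getLast?_cons_cons, abs_div_le_one_iff ha, List.headD_cons]
    tauto

theorem one_le_abs_leadLetter {m : List ℝ} (hm : IsHBar m) : 1 ≤ |leadLetter m| := by
  induction m with
  | nil => simp [leadLetter, nonzeroLetters]
  | cons a m ih =>
    by_cases ha : a = 0
    · subst ha
      rw [leadLetter_zero_cons]
      exact ih ((isHBar_zero_cons m).1 hm)
    · obtain ⟨h1, h2⟩ := (isHBar_cons ha m).1 hm
      rw [leadLetter_cons ha]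
      exact (ih h1).trans h2

theorem IsHBar.of_cons {a : ℝ} {m : List ℝ} (hm : IsHBar (a :: m)) : IsHBar m := by
  by_cases ha : a = 0
  · subst ha; exact (isHBar_zero_cons m).1 hm
  · exact ((isHBar_cons ha m).1 hm).1

theorem IsHBar.lettersGeOne {m : List ℝ} (hm : IsHBar m) : LettersGeOne m := by
  induction m with
  | nil => intro a h; simp at h
  | cons b m ih =>
    intro a h ha
    rcases List.mem_cons.1 h with rfl | h
    · have := one_le_abs_leadLetter hm
      rwa [leadLetter_cons ha] at this
    · exact ih hm.of_cons a h ha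

/-- Nonempty words with positive exponents, nonzero `b_i`, `|b₁| ≤ B`, `|b_i| ≤ 1` for `i ≥ 2`,
and weight at most `N`. -/
def Admissible (B : ℝ) (N : ℕ) : SWord → Prop
  | [] => False
  | p :: v => (1 ≤ p.1 ∧ p.2 ≠ 0 ∧ |p.2| ≤ B) ∧ (∀ q ∈ v, 1 ≤ q.1 ∧ q.2 ≠ 0 ∧ |q.2| ≤ 1) ∧
      sWeight (p :: v) ≤ N

theorem sWeight_cons (p : ℕ × ℝ) (v : SWord) : sWeight (p :: v) = p.1 + sWeight v := by
  simp [sWeight]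

theorem sWeight_scaleHead (r : ℝ) (v : SWord) : sWeight (scaleHead r v) = sWeight v := by
  cases v <;> simp [scaleHead, sWeight]

theorem Admissible.bumpHead {B : ℝ} {N : ℕ} {v : SWord} (h : Admissible B N v) :
    Admissible B (N + 1) (bumpHead v) ∧ sWeight (MellinSums.bumpHead v) = sWeight v + 1 := by
  cases v with
  | nil => exact h.elim
  | cons p v =>
    obtain ⟨⟨h1, h2⟩, h3, h4⟩ := h
    have : sWeight (MellinSums.bumpHead (p :: v)) = sWeight (p :: v) + 1 := by
      simp only [MellinSums.bumpHead, sWeight_cons]; omega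
    exact ⟨⟨⟨by simp, h2⟩, h3, by rw [← MellinSums.bumpHead, this]; omega⟩, this⟩

theorem Admissible.cons_scaleHead {B : ℝ} {N : ℕ} {v : SWord} (h : Admissible B N v) {a : ℝ}
    (ha : a ≠ 0) (hB : B ≤ |a|) :
    Admissible |a| (N + 1) ((1, a) :: scaleHead a⁻¹ v) ∧
      sWeight ((1, a) :: scaleHead a⁻¹ v) = sWeight v + 1 := by
  have hw : sWeight ((1, a) :: scaleHead a⁻¹ v) = sWeight v + 1 := by
    rw [sWeight_cons, sWeight_scaleHead]; omega
  refine ⟨⟨⟨le_rfl, ha, le_rfl⟩, ?_, ?_⟩, hw⟩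
  · cases v with
    | nil => exact h.elim
    | cons p v =>
      obtain ⟨⟨h1, h2, h2'⟩, h3, h4⟩ := h
      intro q hq
      rcases List.mem_cons.1 hq with rfl | hq
      · refine ⟨h1, mul_ne_zero (inv_ne_zero ha) h2, ?_⟩
        rw [abs_mul, abs_inv, inv_mul_le_one₀ (abs_pos.2 ha)]
        exact h2'.trans hB
      · exact h3 q hq
  · rw [hw]
    cases v with
    | nil => exact h.elim
    | cons p v => have := h.2.2; omega

theorem Admissible.isSBar_scaleHead {B : ℝ} {N : ℕ} {v : SWord} (h : Admissible B N v) {r : ℝ}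
    (hr : r ≠ 0) : IsSBar (scaleHead r v) ∧ sWeight (scaleHead r v) ≤ N := by
  rw [sWeight_scaleHead]
  cases v with
  | nil => exact h.elim
  | cons p v =>
    obtain ⟨⟨h1, h2, h2'⟩, h3, h4⟩ := h
    refine ⟨⟨by simp [scaleHead], ?_, fun q hq => (h3 q hq).2.2⟩, h4⟩
    intro q hq
    rcases List.mem_cons.1 hq with rfl | hq
    · exact ⟨h1, mul_ne_zero hr h2⟩
    · exact ⟨(h3 q hq).1, (h3 q hq).2.1⟩

theorem topWord_spec {m : List ℝ} (hm : IsHBar m) :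
    Admissible |leadLetter m| (m.length + 1) (topWord m) ∧
      sWeight (topWord m) = m.length + 1 := by
  induction m with
  | nil => simp [topWord, Admissible, leadLetter, nonzeroLetters, sWeight]
  | cons a m ih =>
    obtain ⟨h1, h2⟩ := ih hm.of_cons
    by_cases ha : a = 0
    · subst ha
      rw [topWord, if_pos rfl, leadLetter_zero_cons, List.length_cons, ← h2, ← h1.bumpHead.2]
      refine ⟨?_, rfl⟩
      have := h1.bumpHead.1
      rwa [← h2, ← h1.bumpHead.2] at this
    · obtain ⟨-, h3⟩ := (isHBar_cons ha m).1 hm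
      obtain ⟨h4, h5⟩ := h1.cons_scaleHead ha h3
      rw [topWord, if_neg ha, leadLetter_cons ha, List.length_cons]
      exact ⟨h4, by rw [h5, h2]⟩

/-! ### Expansion of the moments and of the transform -/

/-- Division by the index, as a linear map on sequences. -/
def divIndex : (ℕ → ℝ) →ₗ[ℝ] (ℕ → ℝ) where
  toFun f j := f j / j
  map_add' f g := by funext j; simp [add_div]
  map_smul' r f := by funext j; simp [mul_div_assoc]

/-- `f ↦ (n ↦ ∑_{j=1}^n r^j f(j))`. -/
def twistedSum (r : ℝ) : (ℕ → ℝ) →ₗ[ℝ] (ℕ → ℝ) where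
  toFun f n := ∑ j ∈ Finset.Icc 1 n, r ^ j * f j
  map_add' f g := by funext n; simp [mul_add, Finset.sum_add_distrib]
  map_smul' k f := by
    funext n
    simp only [Pi.smul_apply, smul_eq_mul, RingHom.id_apply, Finset.mul_sum]
    exact Finset.sum_congr rfl fun j _ => by ring

/-- Multiplication by `a^j`, as a linear map on sequences. -/
def mulPow (a : ℝ) : (ℕ → ℝ) →ₗ[ℝ] (ℕ → ℝ) where
  toFun f j := a ^ j * f j
  map_add' f g := by funext j; simp [mul_add]
  map_smul' r f := by funext j; simp [mul_left_comm]

theorem divIndex_sTerm (v : SWord) : divIndex (sTerm v) = sTerm (bumpHead v) := by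
  funext j
  cases v with
  | nil => simp [divIndex, sTerm, bumpHead]
  | cons p v =>
    simp only [divIndex, sTerm, bumpHead, LinearMap.coe_mk, AddHom.coe_mk]
    rw [pow_succ]
    ring

theorem twistedSum_sTerm (r : ℝ) {v : SWord} (hv : v ≠ []) :
    twistedSum r (sTerm v) = sSum (scaleHead r v) := by
  funext n
  cases v with
  | nil => exact absurd rfl hv
  | cons p v =>
    simp only [twistedSum, sTerm, scaleHead, LinearMap.coe_mk, AddHom.coe_mk, sSum]
    refine Finset.sum_congr rfl fun j _ => ?_
    rw [mul_pow]; ring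

theorem divIndex_mulPow_twistedSum_sTerm (a : ℝ) {v : SWord} (hv : v ≠ []) :
    divIndex (mulPow a (twistedSum a⁻¹ (sTerm v))) = sTerm ((1, a) :: scaleHead a⁻¹ v) := by
  rw [twistedSum_sTerm _ hv]
  funext j
  simp only [divIndex, mulPow, sTerm, LinearMap.coe_mk, AddHom.coe_mk]
  ring

/-- The space spanned by the summands of the admissible words. -/
def termSpan (B : ℝ) (N : ℕ) : Submodule ℝ (ℕ → ℝ) :=
  Submodule.span ℝ (sTerm '' {v | Admissible B N v})

theorem sTerm_mem_termSpan {B : ℝ} {N : ℕ} {v : SWord} (h : Admissible B N v) :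
    sTerm v ∈ termSpan B N := Submodule.subset_span (mem_image_of_mem _ h)

theorem map_mem_of_mem_termSpan {B : ℝ} {N : ℕ} {f : ℕ → ℝ} (hf : f ∈ termSpan B N)
    (F : (ℕ → ℝ) →ₗ[ℝ] (ℕ → ℝ)) (T : Submodule ℝ (ℕ → ℝ))
    (h : ∀ v, Admissible B N v → F (sTerm v) ∈ T) : F f ∈ T := by
  have : termSpan B N ≤ T.comap F := by
    rw [termSpan, Submodule.span_le]
    rintro _ ⟨v, hv, rfl⟩
    exact h v hv
  exact this hf

theorem Admissible.ne_nil {B : ℝ} {N : ℕ} {v : SWord} (h : Admissible B N v) : v ≠ [] := by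
  rintro rfl; exact h

/-- Up to summands of smaller weight, the moment of `H_m` is a nonzero multiple of the summand
that belongs to `topWord m`. -/
theorem exists_moment_eq {m : List ℝ} (hm : IsHBar m) :
    ∃ p : ℝ, p ≠ 0 ∧ ∃ g ∈ termSpan |leadLetter m| m.length,
      ∀ j : ℕ, 1 ≤ j → moment m j = p * sTerm (topWord m) j + g j := by
  induction m with
  | nil =>
    refine ⟨1, one_ne_zero, 0, Submodule.zero_mem _, fun j hj => ?_⟩
    obtain ⟨n, rfl⟩ := Nat.exists_eq_add_of_le' hj
    simp [moment, hpl, topWord, sTerm, sSum]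
  | cons a m ih =>
    obtain ⟨p, hp, g, hg, hmom⟩ := ih hm.of_cons
    have hone : ∀ j : ℕ, sTerm [(1, 1)] j = 1 / j := fun j => by simp [sTerm, sSum]
    by_cases ha : a = 0
    · subst ha
      obtain ⟨L, hL⟩ := exists_moment_zero_cons hm.lettersGeOne
      refine ⟨-p, neg_ne_zero.2 hp, L • sTerm [(1, 1)] - divIndex g, ?_, fun j hj => ?_⟩
      · refine Submodule.sub_mem _ (Submodule.smul_mem _ _ (sTerm_mem_termSpan ?_)) ?_
        · exact ⟨⟨le_rfl, one_ne_zero, by simpa using one_le_abs_leadLetter hm⟩, by simp,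
            by simp [sWeight]⟩
        · refine map_mem_of_mem_termSpan hg _ _ fun v hv => ?_
          rw [divIndex_sTerm, leadLetter_zero_cons]
          exact sTerm_mem_termSpan hv.bumpHead.1
      · rw [hL j hj, hmom j hj, topWord, if_pos rfl, ← divIndex_sTerm]
        simp only [Pi.sub_apply, Pi.smul_apply, smul_eq_mul, hone, divIndex, LinearMap.coe_mk,
          AddHom.coe_mk]
        ring
    · obtain ⟨hm', hle⟩ := (isHBar_cons ha m).1 hm
      have ha1 : 1 ≤ |a| := hm.lettersGeOne a List.mem_cons_self ha
      obtain ⟨L, hL⟩ := exists_moment_cons hm.lettersGeOne ha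
      have hsg := neg_sign_eq_one_or ha
      have hsg0 : Real.sign a ≠ 0 := by
        intro h; rw [h] at hsg; norm_num at hsg
      set K := mellinTransform (hpl m) |a| (-Real.sign a) 0 with hK
      refine ⟨Real.sign a * p, mul_ne_zero hsg0 hp, L • sTerm [(1, 1)] - K • sTerm [(1, a)] +
        Real.sign a • (divIndex.comp ((mulPow a).comp (twistedSum a⁻¹))) g, ?_, fun j hj => ?_⟩
      · rw [leadLetter_cons ha]
        refine Submodule.add_mem _ (Submodule.sub_mem _
          (Submodule.smul_mem _ _ (sTerm_mem_termSpan ?_))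
          (Submodule.smul_mem _ _ (sTerm_mem_termSpan ?_))) (Submodule.smul_mem _ _ ?_)
        · exact ⟨⟨le_rfl, one_ne_zero, by simpa using ha1⟩, by simp, by simp [sWeight]⟩
        · exact ⟨⟨le_rfl, ha, le_rfl⟩, by simp, by simp [sWeight]⟩
        · refine map_mem_of_mem_termSpan hg _ _ fun v hv => ?_
          simp only [LinearMap.comp_apply]
          rw [divIndex_mulPow_twistedSum_sTerm a hv.ne_nil]
          exact sTerm_mem_termSpan (hv.cons_scaleHead ha hle).1
      · have hsum : ∑ i ∈ Finset.Icc 1 j, a⁻¹ ^ i * moment m i =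
            p * twistedSum a⁻¹ (sTerm (topWord m)) j + twistedSum a⁻¹ g j := by
          simp only [twistedSum, LinearMap.coe_mk, AddHom.coe_mk]
          rw [Finset.mul_sum, ← Finset.sum_add_distrib]
          refine Finset.sum_congr rfl fun i hi => ?_
          rw [hmom i (Finset.mem_Icc.1 hi).1]; ring
        rw [hL j hj, mellinTransform_eq_sum_moment hm'.lettersGeOne (abs_ne_zero.2 ha) hsg,
          prefactor_abs_neg_sign ha ha1, pole_abs_neg_sign ha, hsum, ← hK, topWord, if_neg ha,
          ← divIndex_mulPow_twistedSum_sTerm a (topWord_spec hm').1.ne_nil]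
        have hta : sTerm [(1, a)] j = a ^ j / j := by simp [sTerm, sSum]
        simp only [Pi.sub_apply, Pi.add_apply, Pi.smul_apply, smul_eq_mul, hone, hta,
          LinearMap.comp_apply, divIndex, mulPow, LinearMap.coe_mk, AddHom.coe_mk]
        ring

/-- The space spanned by the `S̄`-sums of weight at most `N`. -/
def sumSpan (N : ℕ) : Submodule ℝ (ℕ → ℝ) :=
  Submodule.span ℝ (sSum '' {v | IsSBar v ∧ sWeight v ≤ N})

/-- The index of the leading sum in the transform of `H_m(x)/(c + d x)`. -/
def mellinWord (m : List ℝ) (c d : ℝ) : SWord := scaleHead (pole c d)⁻¹ (topWord m)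

theorem mellinWord_spec {m : List ℝ} (hm : IsHBar m) {c d : ℝ} (hc : c ≠ 0) (hd : d ≠ 0) :
    IsSBar (mellinWord m c d) ∧ sWeight (mellinWord m c d) = m.length + 1 := by
  obtain ⟨h1, h2⟩ := topWord_spec hm
  refine ⟨(h1.isSBar_scaleHead (inv_ne_zero (pole_ne_zero hc hd))).1, ?_⟩
  rw [mellinWord, sWeight_scaleHead, h2]

theorem exists_mellinTransform_eq {m : List ℝ} (hm : IsHBar m) {c d : ℝ} (hc : c ≠ 0)
    (hd : d = 1 ∨ d = -1) :
    ∃ p t₀ : ℝ, p ≠ 0 ∧ ∃ g ∈ sumSpan m.length, ∀ n : ℕ, mellinTransform (hpl m) c d n =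
      prefactor c d n * (p * sSum (mellinWord m c d) n + (t₀ + g n)) := by
  have hd0 : d ≠ 0 := by rcases hd with rfl | rfl <;> norm_num
  obtain ⟨p, hp, g, hg, hmom⟩ := exists_moment_eq hm
  refine ⟨d * p, mellinTransform (hpl m) c d 0, mul_ne_zero hd0 hp,
    d • twistedSum (pole c d)⁻¹ g, ?_, fun n => ?_⟩
  · refine Submodule.smul_mem _ _ (map_mem_of_mem_termSpan hg _ _ fun v hv => ?_)
    rw [twistedSum_sTerm _ hv.ne_nil]
    exact Submodule.subset_span
      (mem_image_of_mem _ (hv.isSBar_scaleHead (inv_ne_zero (pole_ne_zero hc hd0))))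
  · rw [mellinTransform_eq_sum_moment hm.lettersGeOne hc hd, mellinWord,
      ← twistedSum_sTerm _ (topWord_spec hm).1.ne_nil]
    simp only [Pi.smul_apply, smul_eq_mul, twistedSum, LinearMap.coe_mk, AddHom.coe_mk]
    congr 1
    have : ∑ j ∈ Finset.Icc 1 n, (pole c d)⁻¹ ^ j * moment m j =
        p * (∑ j ∈ Finset.Icc 1 n, (pole c d)⁻¹ ^ j * sTerm (topWord m) j) +
          ∑ j ∈ Finset.Icc 1 n, (pole c d)⁻¹ ^ j * g j := by
      rw [Finset.mul_sum, ← Finset.sum_add_distrib]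
      refine Finset.sum_congr rfl fun i hi => ?_
      rw [hmom i (Finset.mem_Icc.1 hi).1]; ring
    rw [this]; ring

theorem isMostComplicated_mellinWord {m : List ℝ} (hm : IsHBar m) {c d : ℝ} (hc : c ≠ 0)
    (hd : d = 1 ∨ d = -1) : IsMostComplicated m c d (mellinWord m c d) := by
  have hd0 : d ≠ 0 := by rcases hd with rfl | rfl <;> norm_num
  obtain ⟨h1, h2⟩ := mellinWord_spec hm hc hd0
  obtain ⟨p, t₀, hp, g, hg, hM⟩ := exists_mellinTransform_eq hm hc hd
  obtain ⟨t, ht, rfl⟩ := (Finsupp.mem_span_image_iff_linearCombination ℝ).1 hg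
  refine ⟨h1, p, t₀, t, hp, fun v hv => ?_, fun n _ => ?_⟩
  · obtain ⟨h3, h4⟩ := (Finsupp.mem_supported _ _).1 ht hv
    exact ⟨h3, Or.inl (by rw [h2]; omega)⟩
  · rw [hM n, Finsupp.linearCombination_apply, Finsupp.sum, Finset.sum_apply]
    rfl

/-! ### The last entry of the leading word -/

/-- For positive exponents: the word is not `[(1, b)]` and does not end in `(1, 1)`. Unlike the second
condition alone, this is stable under scaling the first entry. -/
def EndsWell (v : SWord) : Prop :=
  ∃ v' p, v = v' ++ [p] ∧ (2 ≤ p.1 ∨ (v' ≠ [] ∧ p.2 ≠ 1))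

theorem EndsWell.scaleHead {v : SWord} (h : EndsWell v) (r : ℝ) : EndsWell (scaleHead r v) := by
  obtain ⟨v', p, rfl, h⟩ := h
  cases v' with
  | nil =>
    have h2 : 2 ≤ p.1 := by simpa using h
    exact ⟨[], (p.1, r * p.2), rfl, Or.inl h2⟩
  | cons q v' => exact ⟨(q.1, r * q.2) :: v', p, rfl, by simpa using h⟩

theorem EndsWell.bumpHead {v : SWord} (h : EndsWell v) : EndsWell (bumpHead v) := by
  obtain ⟨v', p, rfl, h⟩ := h
  cases v' with
  | nil =>
    have h2 : 2 ≤ p.1 := by simpa using h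
    exact ⟨[], (p.1 + 1, p.2), rfl, Or.inl (by omega)⟩
  | cons q v' => exact ⟨(q.1 + 1, q.2) :: v', p, rfl, by simpa using h⟩

theorem EndsWell.cons {v : SWord} (h : EndsWell v) (q : ℕ × ℝ) : EndsWell (q :: v) := by
  obtain ⟨v', p, rfl, h⟩ := h
  exact ⟨q :: v', p, rfl, h.imp_right fun h => ⟨by simp, h.2⟩⟩

theorem EndsWell.getLast?_ne {v : SWord} (h : EndsWell v) : v.getLast? ≠ some (1, 1) := by
  obtain ⟨v', p, rfl, h⟩ := h
  rw [List.getLast?_append, List.getLast?_singleton]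
  simp only [Option.some_or, ne_eq, Option.some.injEq]
  rintro rfl
  simp at h

theorem endsWell_topWord {m : List ℝ} (h0 : m ≠ []) (h1 : m.getLast? ≠ some 1) :
    EndsWell (topWord m) := by
  induction m with
  | nil => exact absurd rfl h0
  | cons a m ih =>
    cases m with
    | nil =>
      by_cases ha : a = 0
      · subst ha
        exact ⟨[], (2, 1), by simp [topWord, bumpHead], Or.inl le_rfl⟩
      · refine ⟨[(1, a)], (1, a⁻¹), by simp [topWord, scaleHead, ha], Or.inr ⟨by simp, ?_⟩⟩
        have : a ≠ 1 := by simpa using h1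
        simpa using this
    | cons b m =>
      have := ih (by simp) (by rwa [List.getLast?_cons_cons] at h1)
      rw [topWord]
      split_ifs
      · exact this.bumpHead
      · exact (this.scaleHead _).cons _

end

/-! ### Inverting the correspondence between words -/

/-- The product of the `1 / b_i`. -/
def recipProd : SWord → ℝ
  | [] => 1
  | p :: w => recipProd w / p.2

/-- For every entry `(a_i, b_i)` the letter `1/(b_i ⋯ b_l)` followed by `a_i - 1` zeros. The first
letter is the pole that the inverse transform needs, the other letters form the polylogarithm. -/
def poleAndLetters : SWord → List ℝ
  | [] => []
  | p :: w => recipProd (p :: w) :: (List.replicate (p.1 - 1) 0 ++ poleAndLetters w)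

theorem recipProd_ne_zero {w : SWord} (hw : ∀ p ∈ w, p.2 ≠ 0) : recipProd w ≠ 0 := by
  induction w with
  | nil => exact one_ne_zero
  | cons p w ih =>
    exact div_ne_zero (ih fun q hq => hw q (List.mem_cons_of_mem _ hq)) (hw p List.mem_cons_self)

theorem one_le_abs_recipProd {w : SWord} (hw : ∀ p ∈ w, p.2 ≠ 0 ∧ |p.2| ≤ 1) :
    1 ≤ |recipProd w| := by
  induction w with
  | nil => simp [recipProd]
  | cons p w ih =>
    obtain ⟨h1, h2⟩ := hw p List.mem_cons_self
    rw [recipProd, abs_div, le_div_iff₀ (abs_pos.2 h1), one_mul]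
    exact h2.trans (ih fun q hq => hw q (List.mem_cons_of_mem _ hq))

theorem leadLetter_replicate_append (k : ℕ) (m : List ℝ) :
    leadLetter (List.replicate k 0 ++ m) = leadLetter m := by
  induction k with
  | zero => rfl
  | succ k ih => rw [List.replicate_succ, List.cons_append, leadLetter_zero_cons, ih]

theorem isHBar_replicate_append (k : ℕ) (m : List ℝ) :
    IsHBar (List.replicate k 0 ++ m) ↔ IsHBar m := by
  induction k with
  | zero => rfl
  | succ k ih => rw [List.replicate_succ, List.cons_append, isHBar_zero_cons, ih]

theorem topWord_replicate_append (k : ℕ) {m : List ℝ} {p : ℕ × ℝ} {v : SWord}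
    (h : topWord m = p :: v) :
    topWord (List.replicate k 0 ++ m) = (p.1 + k, p.2) :: v := by
  induction k with
  | zero => exact h
  | succ k ih =>
    rw [List.replicate_succ, List.cons_append, topWord, if_pos rfl, ih]
    rfl

theorem isHBar_poleAndLetters {w : SWord} (hw : ∀ p ∈ w, p.2 ≠ 0 ∧ |p.2| ≤ 1) :
    IsHBar (poleAndLetters w) ∧ leadLetter (poleAndLetters w) = recipProd w := by
  induction w with
  | nil => exact ⟨isHBar_nil, by simp [leadLetter, poleAndLetters, nonzeroLetters, recipProd]⟩
  | cons p w ih =>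
    obtain ⟨h1, h2⟩ := ih fun q hq => hw q (List.mem_cons_of_mem _ hq)
    obtain ⟨h3, h4⟩ := hw p List.mem_cons_self
    have h5 : recipProd (p :: w) ≠ 0 := recipProd_ne_zero fun q hq => (hw q hq).1
    rw [poleAndLetters]
    refine ⟨?_, leadLetter_cons h5 _⟩
    rw [isHBar_cons h5, isHBar_replicate_append, leadLetter_replicate_append, h2, recipProd,
      abs_div, le_div_iff₀ (abs_pos.2 h3)]
    exact ⟨h1, mul_le_of_le_one_right (abs_nonneg _) h4⟩

theorem length_poleAndLetters {w : SWord} (hw : ∀ p ∈ w, 1 ≤ p.1) :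
    (poleAndLetters w).length = sWeight w := by
  induction w with
  | nil => rfl
  | cons p w ih =>
    have h1 := ih fun q hq => hw q (List.mem_cons_of_mem _ hq)
    have h2 := hw p List.mem_cons_self
    rw [poleAndLetters, sWeight_cons, List.length_cons, List.length_append, List.length_replicate,
      h1]
    omega

theorem scaleHead_topWord_tail_poleAndLetters {w : SWord} (hw : ∀ p ∈ w, 1 ≤ p.1 ∧ p.2 ≠ 0)
    (h0 : w ≠ []) :
    scaleHead (recipProd w)⁻¹ (topWord (poleAndLetters w).tail) = w := by
  induction w with
  | nil => exact absurd rfl h0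
  | cons p w ih =>
    obtain ⟨h1, h2⟩ := hw p List.mem_cons_self
    have h3 : recipProd w ≠ 0 := recipProd_ne_zero fun q hq => (hw q (List.mem_cons_of_mem _ hq)).2
    have h4 : (recipProd w / p.2)⁻¹ * recipProd w = p.2 := by field_simp
    have h5 : topWord (poleAndLetters w) = (1, recipProd w) :: w := by
      cases w with
      | nil => rfl
      | cons q w =>
        have h6 := ih (fun q hq => hw q (List.mem_cons_of_mem _ hq)) (by simp)
        rw [poleAndLetters, List.tail_cons] at h6
        rw [poleAndLetters, topWord, if_neg h3, h6]
    rw [poleAndLetters, List.tail_cons, topWord_replicate_append _ h5, scaleHead, recipProd, h4]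
    congr 1
    ext
    · simp only; omega
    · rfl

theorem getLast?_poleAndLetters_ne {w : SWord} (hw : ∀ p ∈ w, 1 ≤ p.1 ∧ p.2 ≠ 0)
    (h : w.getLast? ≠ some (1, 1)) : (poleAndLetters w).getLast? ≠ some 1 := by
  induction w with
  | nil => simp [poleAndLetters]
  | cons p w ih =>
    obtain ⟨h1, h2⟩ := hw p List.mem_cons_self
    cases w with
    | nil =>
      rw [poleAndLetters, poleAndLetters, List.append_nil]
      obtain ⟨a, b⟩ := p
      obtain ⟨k, rfl⟩ : ∃ k, a = k + 1 := ⟨a - 1, by simp at h1; omega⟩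
      cases k with
      | zero =>
        have : b ≠ 1 := by rintro rfl; simp at h
        simpa [recipProd] using this
      | succ k =>
        simp [List.getLast?_cons, List.getLast?_replicate]
    | cons q w =>
      have h3 := ih (fun q hq => hw q (List.mem_cons_of_mem _ hq))
        (by rwa [List.getLast?_cons_cons] at h)
      have h4 : (poleAndLetters (q :: w)).getLast? ≠ none := by simp [poleAndLetters]
      rw [poleAndLetters, ← List.cons_append, List.getLast?_append]
      cases hx : (poleAndLetters (q :: w)).getLast? with
      | none => exact absurd hx h4
      | some x => rw [hx] at h3; simpa using h3

theorem getLast?_tail_poleAndLetters_ne {w : SWord} (hw : ∀ p ∈ w, 1 ≤ p.1 ∧ p.2 ≠ 0)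
    (h : w.getLast? ≠ some (1, 1)) : (poleAndLetters w).tail.getLast? ≠ some 1 := by
  have h1 := getLast?_poleAndLetters_ne hw h
  cases hx : poleAndLetters w with
  | nil => simp
  | cons x l =>
    rw [hx] at h1
    cases l with
    | nil => simp
    | cons y l => rwa [List.getLast?_cons_cons] at h1

/-! ### The program -/

theorem Exec.seq_instr {i : Instr} {Q : Prog} {s u : Store} (h : Exec Q (i.run s) u) :
    Exec (.seq (.instr i) Q) s u := Exec.seq (Exec.instr i s) h

/-- Move the contents of stack `0` to stack `1`, which reverses them. -/
def revProg : Prog := .loop (.nonempty 0) (.seq (.instr (.copy 0 1)) (.instr (.pop 0)))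

/-- Turn the number on top of stack `1` from `k` into `0` and push `k` zeros onto stack `0`. -/
def zerosProg : Prog := .loop (.pos 1)
  (.seq (.instr (.push 0 0)) (.seq (.instr (.push 1 1)) (.instr (.sub 1))))

/-- Process one entry: stack `1` holds `b` and `a`, stack `2` the product `u` of the reciprocals
so far. Replace `u` by `u / b`, and push `a - 1` zeros and the new `u` onto stack `0`. -/
def entryProg : Prog :=
  .seq (.instr (.copy 1 2)) (.seq (.instr (.div 2)) (.seq (.instr (.pop 1))
    (.seq (.instr (.push 1 1)) (.seq (.instr (.sub 1)) (.seq zerosProg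
      (.seq (.instr (.pop 1)) (.instr (.copy 2 0))))))))

/-- Replace the pole `s` on top of stack `0`, which is also on top of stack `2`, by `|s|` and
`-sign s`. -/
def signProg : Prog := .branch (.pos 0)
  (.seq (.instr (.pop 0)) (.seq (.instr (.push 0 (-1))) (.instr (.copy 2 0))))
  (.seq (.instr (.pop 0)) (.seq (.instr (.push 0 1)) (.seq (.instr (.push 0 0))
    (.seq (.instr (.copy 2 0)) (.instr (.sub 0))))))

/-- The program that computes the inverse Mellin transform of the leading sum. -/
def inverseProg : Prog :=
  .seq revProg (.seq (.instr (.push 2 1)) (.seq (.loop (.nonempty 1) entryProg) signProg))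

/-- The store whose first three stacks are given and whose other stacks are empty. -/
def store3 (l₀ l₁ l₂ : List ℝ) : Store
  | 0 => l₀
  | 1 => l₁
  | 2 => l₂
  | _ => []

theorem update_store3_zero (l l₀ l₁ l₂ : List ℝ) :
    Function.update (store3 l₀ l₁ l₂) 0 l = store3 l l₁ l₂ := by
  funext k; obtain _ | _ | _ | k := k <;> rfl

theorem update_store3_one (l l₀ l₁ l₂ : List ℝ) :
    Function.update (store3 l₀ l₁ l₂) 1 l = store3 l₀ l l₂ := by
  funext k; obtain _ | _ | _ | k := k <;> rfl

theorem update_store3_two (l l₀ l₁ l₂ : List ℝ) :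
    Function.update (store3 l₀ l₁ l₂) 2 l = store3 l₀ l₁ l := by
  funext k; obtain _ | _ | _ | k := k <;> rfl

theorem exec_instr_of_eq {i : Instr} {s t : Store} (h : i.run s = t) : Exec (.instr i) s t :=
  h ▸ Exec.instr i s

theorem exec_revProg (l₀ l₁ l₂ : List ℝ) :
    Exec revProg (store3 l₀ l₁ l₂) (store3 [] (l₀.reverse ++ l₁) l₂) := by
  induction l₀ generalizing l₁ with
  | nil => exact Exec.loop_false (by simp [Test.holds, store3])
  | cons x l ih =>
    refine Exec.loop_true (by simp [Test.holds, store3])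
      (Exec.seq_instr (exec_instr_of_eq (t := store3 l (x :: l₁) l₂) ?_)) ?_
    · simp [Instr.run, update_store3_zero, update_store3_one, store3]
    · have := ih (x :: l₁)
      rwa [List.reverse_cons, List.append_assoc, List.singleton_append]

theorem exec_zerosProg (k : ℕ) (l₀ l₁ l₂ : List ℝ) :
    Exec zerosProg (store3 l₀ ((k : ℝ) :: l₁) l₂)
      (store3 (List.replicate k 0 ++ l₀) (0 :: l₁) l₂) := by
  induction k generalizing l₀ with
  | zero =>
    rw [Nat.cast_zero]
    exact Exec.loop_false (by simp [Test.holds, store3])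
  | succ k ih =>
    refine Exec.loop_true (by simp [Test.holds, store3]; positivity)
      (t := store3 (0 :: l₀) ((k : ℝ) :: l₁) l₂)
      (Exec.seq_instr (Exec.seq_instr (exec_instr_of_eq ?_))) ?_
    · simp [Instr.run, binop, update_store3_zero, update_store3_one, store3]
    · have := ih (0 :: l₀)
      rwa [List.replicate_succ', List.append_assoc, List.singleton_append]

theorem exec_entryProg (a : ℕ) (ha : 1 ≤ a) (b u : ℝ) (l₀ l₁ l₂ : List ℝ) :
    Exec entryProg (store3 l₀ (b :: (a : ℝ) :: l₁) (u :: l₂))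
      (store3 (u / b :: (List.replicate (a - 1) 0 ++ l₀)) l₁ (u / b :: l₂)) := by
  obtain ⟨k, rfl⟩ := Nat.exists_eq_add_of_le' ha
  refine Exec.seq_instr (Exec.seq_instr (Exec.seq_instr (Exec.seq_instr (Exec.seq_instr
    (Exec.seq (t := store3 (List.replicate k 0 ++ l₀) (0 :: l₁) (u / b :: l₂)) ?_
      (Exec.seq_instr (exec_instr_of_eq ?_)))))))
  · have := exec_zerosProg k l₀ l₁ (u / b :: l₂)
    convert this using 1
    simp [Instr.run, binop, update_store3_one, update_store3_two, store3]
  · simp [Instr.run, update_store3_zero, update_store3_one, store3]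

theorem encodeSWord_append (v w : SWord) :
    encodeSWord (v ++ w) = encodeSWord v ++ encodeSWord w := by
  simp [encodeSWord]

/-- The main loop works through the entries from the last to the first: when `w` has been
processed, stack `0` holds `poleAndLetters w` and stack `2` the product of the reciprocals. -/
theorem exec_entry_loop (v w : SWord) (hv : ∀ p ∈ v, 1 ≤ p.1) :
    Exec (.loop (.nonempty 1) entryProg)
      (store3 (poleAndLetters w) (encodeSWord v).reverse [recipProd w])
      (store3 (poleAndLetters (v ++ w)) [] [recipProd (v ++ w)]) := by
  induction v using List.reverseRecOn generalizing w with
  | nil => exact Exec.loop_false (by simp [Test.holds, store3, encodeSWord])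
  | append_singleton v p ih =>
    have hstep := exec_entryProg p.1 (hv p (by simp)) p.2 (recipProd w) (poleAndLetters w)
      (encodeSWord v).reverse []
    have hin : (encodeSWord (v ++ [p])).reverse = p.2 :: (p.1 : ℝ) :: (encodeSWord v).reverse := by
      rw [encodeSWord_append, List.reverse_append]
      simp [encodeSWord]
    rw [hin]
    refine Exec.loop_true (by simp [Test.holds, store3]) hstep ?_
    have := ih (p :: w) fun q hq => hv q (by simp [hq])
    rwa [List.append_assoc, List.singleton_append]

theorem exec_signProg {s : ℝ} (hs : s ≠ 0) (m : List ℝ) :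
    Exec signProg (store3 (s :: m) [] [s]) (store3 (|s| :: -Real.sign s :: m) [] [s]) := by
  rcases lt_or_gt_of_ne hs with h | h
  · refine Exec.branch_false (by simpa [Test.holds, store3] using h.le)
      (Exec.seq_instr (Exec.seq_instr (Exec.seq_instr (Exec.seq_instr (exec_instr_of_eq ?_)))))
    simp [Instr.run, binop, update_store3_zero, store3, abs_of_neg h, Real.sign_of_neg h]
  · refine Exec.branch_true (by simpa [Test.holds, store3] using h)
      (Exec.seq_instr (Exec.seq_instr (exec_instr_of_eq ?_)))
    simp [Instr.run, update_store3_zero, store3, abs_of_pos h, Real.sign_of_pos h]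

theorem outputs_inverseProg {w : SWord} (hw : ∀ p ∈ w, 1 ≤ p.1 ∧ p.2 ≠ 0) (h0 : w ≠ []) :
    inverseProg.Outputs (encodeSWord w)
      (|recipProd w| :: -Real.sign (recipProd w) :: (poleAndLetters w).tail) := by
  refine ⟨store3 (|recipProd w| :: -Real.sign (recipProd w) :: (poleAndLetters w).tail) []
    [recipProd w], ?_, rfl⟩
  have hstart : (fun k => if k = 0 then encodeSWord w else [] : Store) =
      store3 (encodeSWord w) [] [] := by
    funext k; obtain _ | _ | _ | k := k <;> rfl
  rw [hstart]
  refine Exec.seq (exec_revProg _ _ _) (Exec.seq_instr (Exec.seq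
    (t := store3 (poleAndLetters w) [] [recipProd w]) ?_ ?_))
  · have := exec_entry_loop w [] fun p hp => (hw p hp).1
    rw [List.append_nil] at this
    convert this using 1
    simp [Instr.run, update_store3_two, store3, poleAndLetters, recipProd]
  · have hp : poleAndLetters w = recipProd w :: (poleAndLetters w).tail := by
      cases w with
      | nil => exact absurd rfl h0
      | cons p w => rfl
    have := exec_signProg (recipProd_ne_zero fun p hp => (hw p hp).2) (poleAndLetters w).tail
    rwa [← hp] at this

section

open Polynomial Filter

/-! ### The difference field of rational functions -/

theorem comp_X_add_one_mem_nonZeroDivisors :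
    nonZeroDivisors ℝ[X] ≤ (nonZeroDivisors ℝ[X]).comap (compRingHom (X + 1 : ℝ[X])) := by
  intro p hp
  rw [Submonoid.mem_comap, mem_nonZeroDivisors_iff_ne_zero]
  rw [mem_nonZeroDivisors_iff_ne_zero] at hp
  intro h
  apply hp
  have h1 : (p.comp (X + 1)).comp (X - 1) = 0 := by
    rw [show p.comp (X + 1) = 0 from h, zero_comp]
  simpa [comp_assoc] using h1

/-- The shift `r(X) ↦ r(X + 1)` on rational functions. -/
def ratShift : RatFunc ℝ →+* RatFunc ℝ :=
  IsLocalization.map (RatFunc ℝ) (compRingHom (X + 1 : ℝ[X])) comp_X_add_one_mem_nonZeroDivisors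

theorem ratShift_algebraMap (p : ℝ[X]) :
    ratShift (algebraMap ℝ[X] (RatFunc ℝ) p) = algebraMap ℝ[X] (RatFunc ℝ) (p.comp (X + 1)) :=
  IsLocalization.map_eq _ _

/-- A real constant as a rational function. -/
abbrev ratC (c : ℝ) : RatFunc ℝ := algebraMap ℝ[X] (RatFunc ℝ) (C c)

theorem ratShift_ratC (c : ℝ) : ratShift (ratC c) = ratC c := by
  rw [ratShift_algebraMap, C_comp]

theorem ratC_ne_zero {c : ℝ} (hc : c ≠ 0) : ratC c ≠ 0 := by
  simpa [ratC] using hc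

theorem exists_eq_div (r : RatFunc ℝ) :
    ∃ p q : ℝ[X], q ≠ 0 ∧ r * algebraMap ℝ[X] (RatFunc ℝ) q = algebraMap ℝ[X] (RatFunc ℝ) p := by
  obtain ⟨⟨p, q⟩, h⟩ := IsLocalization.surj (nonZeroDivisors ℝ[X]) r
  exact ⟨p, q, nonZeroDivisors.ne_zero q.2, h⟩

theorem algebraMap_ratFunc_injective : Function.Injective (algebraMap ℝ[X] (RatFunc ℝ)) :=
  IsFractionRing.injective ℝ[X] (RatFunc ℝ)

theorem eventually_eval_natCast_ne_zero {p : ℝ[X]} (hp : p ≠ 0) :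
    ∀ᶠ n : ℕ in atTop, p.eval (n : ℝ) ≠ 0 := by
  obtain ⟨B, hB⟩ := p.roots.toFinset.finite_toSet.bddAbove
  have h : ∀ᶠ x : ℝ in atTop, p.eval x ≠ 0 := by
    filter_upwards [eventually_gt_atTop B] with x hx hx0
    have : x ∈ (p.roots.toFinset : Set ℝ) := by simpa [hp] using hx0
    exact absurd (hB this) (not_le.mpr hx)
  exact tendsto_natCast_atTop_atTop.eventually h

/-- A rational solution of `q r(X + 1) = r(X)` is zero, or it is constant and `q = 1`. -/
theorem eq_const_of_mul_ratShift_eq {q : ℝ} {r : RatFunc ℝ} (h : ratC q * ratShift r = r)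
    (hr : r ≠ 0) : q = 1 ∧ ∃ k : ℝ, r = ratC k := by
  obtain ⟨p, d, hd, hpd⟩ := exists_eq_div r
  have hdK : algebraMap ℝ[X] (RatFunc ℝ) d ≠ 0 := by
    simpa using hd
  have hp : p ≠ 0 := by
    rintro rfl
    rw [map_zero] at hpd
    exact (mul_ne_zero hr hdK) hpd
  have h2 : ratShift r * algebraMap ℝ[X] (RatFunc ℝ) (d.comp (X + 1))
      = algebraMap ℝ[X] (RatFunc ℝ) (p.comp (X + 1)) := by
    rw [← ratShift_algebraMap, ← map_mul, hpd, ratShift_algebraMap]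
  have h3 : C q * p.comp (X + 1) * d = p * d.comp (X + 1) := by
    apply algebraMap_ratFunc_injective
    simp only [map_mul]
    rw [← h2, ← hpd]
    calc _ = (ratC q * ratShift r) * (algebraMap ℝ[X] (RatFunc ℝ) (d.comp (X + 1)) *
            algebraMap ℝ[X] (RatFunc ℝ) d) := by ring
      _ = _ := by rw [h]; ring
  have hX : (X + 1 : ℝ[X]).natDegree ≠ 0 := by
    rw [show (X + 1 : ℝ[X]) = X + C 1 by simp, natDegree_X_add_C]; norm_num
  have hl : (X + 1 : ℝ[X]).leadingCoeff = 1 := by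
    rw [show (X + 1 : ℝ[X]) = X + C 1 by simp, leadingCoeff_X_add_C]
  have hq : q = 1 := by
    have h4 := congrArg leadingCoeff h3
    simp only [leadingCoeff_mul, leadingCoeff_comp hX, hl, leadingCoeff_C, one_pow, mul_one] at h4
    have : p.leadingCoeff * d.leadingCoeff ≠ 0 :=
      mul_ne_zero (by simpa using hp) (by simpa using hd)
    apply mul_right_cancel₀ this
    linarith
  refine ⟨hq, ?_⟩
  subst hq
  rw [C_1, one_mul] at h3
  -- `d` has no zeros beyond some `N`, and there `p / d` is invariant under `n ↦ n + 1`
  obtain ⟨N, hN⟩ : ∃ N : ℕ, ∀ n ≥ N, d.eval (n : ℝ) ≠ 0 :=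
    eventually_atTop.1 (eventually_eval_natCast_ne_zero hd)
  set k : ℝ := p.eval (N : ℝ) / d.eval (N : ℝ) with hk
  have h6 : ∀ n ≥ N, p.eval (n : ℝ) = k * d.eval (n : ℝ) := by
    intro n hn
    induction n, hn using Nat.le_induction with
    | base => rw [hk, div_mul_cancel₀ _ (hN N le_rfl)]
    | succ n hn ih =>
      have h7 := congrArg (fun f => eval (n : ℝ) f) h3
      simp only [eval_mul, eval_comp, eval_add, eval_X, eval_one] at h7
      rw [ih] at h7
      push_cast
      apply mul_right_cancel₀ (hN n hn)
      rw [h7]; ring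
  refine ⟨k, ?_⟩
  have h8 : p = C k * d := by
    apply eq_of_infinite_eval_eq
    apply ((Set.infinite_of_not_bddAbove (s := Set.Ici N) (not_bddAbove_Ici N)).image
      (f := fun n : ℕ => (n : ℝ)) Nat.cast_injective.injOn).mono
    rintro _ ⟨n, hn, rfl⟩
    simpa using h6 n hn
  apply mul_right_cancel₀ hdK
  rw [hpd, h8, map_mul]

/-- The rational function `r` has no pole at the real number `x`. -/
def RegularAt (r : RatFunc ℝ) (x : ℝ) : Prop :=
  ∃ p q : ℝ[X], q.eval x ≠ 0 ∧
    r * algebraMap ℝ[X] (RatFunc ℝ) q = algebraMap ℝ[X] (RatFunc ℝ) p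

theorem RegularAt.add {r s : RatFunc ℝ} {x : ℝ} (hr : RegularAt r x) (hs : RegularAt s x) :
    RegularAt (r + s) x := by
  obtain ⟨p, q, hq, h⟩ := hr
  obtain ⟨p', q', hq', h'⟩ := hs
  refine ⟨p * q' + p' * q, q * q', by simpa using ⟨hq, hq'⟩, ?_⟩
  simp only [map_add, map_mul, ← h, ← h']
  ring

theorem RegularAt.const_mul {r : RatFunc ℝ} {x : ℝ} (c : ℝ) (hr : RegularAt r x) :
    RegularAt (ratC c * r) x := by
  obtain ⟨p, q, hq, h⟩ := hr
  refine ⟨C c * p, q, hq, ?_⟩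
  rw [map_mul, ← h]; ring

theorem RegularAt.ratShift {r : RatFunc ℝ} {x : ℝ} (hr : RegularAt r (x + 1)) :
    RegularAt (ratShift r) x := by
  obtain ⟨p, q, hq, h⟩ := hr
  refine ⟨p.comp (X + 1), q.comp (X + 1), by simpa using hq, ?_⟩
  rw [← ratShift_algebraMap, ← map_mul, h, ratShift_algebraMap]

theorem RegularAt.of_ratShift {r : RatFunc ℝ} {x : ℝ} (hr : RegularAt (MellinSums.ratShift r) x) :
    RegularAt r (x + 1) := by
  obtain ⟨p, q, hq, h⟩ := hr
  refine ⟨p.comp (X - 1), q.comp (X - 1), by simpa using hq, ?_⟩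
  apply MellinSums.ratShift.injective
  rw [map_mul, ratShift_algebraMap, ratShift_algebraMap]
  simpa [comp_assoc] using h

theorem exists_regularAt_of_abs_gt (r : RatFunc ℝ) : ∃ B : ℝ, ∀ x, B < |x| → RegularAt r x := by
  obtain ⟨p, d, hd, hpd⟩ := exists_eq_div r
  obtain ⟨B, hB⟩ := (d.roots.toFinset.finite_toSet.image (fun x => |x|)).bddAbove
  refine ⟨B, fun x hx => ⟨p, d, fun hx0 => ?_, hpd⟩⟩
  have : x ∈ (d.roots.toFinset : Set ℝ) := by simpa [hd] using hx0
  exact absurd (hB (Set.mem_image_of_mem _ this)) (not_le.mpr hx)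

/-- If `h = r - q r(X + 1)` has no pole on the integers except possibly at `-1`, then it has none
there either: the leftmost and the rightmost integral pole of `r` would both be visible in `h`. -/
theorem regularAt_neg_one {q : ℝ} (hq : q ≠ 0) {r h : RatFunc ℝ}
    (he : ratC q * ratShift r - r + h = 0) (hh : ∀ x : ℝ, x ≠ -1 → RegularAt h x) :
    RegularAt h (-1) := by
  obtain ⟨B, hB⟩ := exists_regularAt_of_abs_gt r
  obtain ⟨N, hN⟩ := exists_nat_gt |B|
  have hBN : B < N := (le_abs_self B).trans_lt hN
  have hne : ∀ x : ℝ, x ≠ -1 → RegularAt r x → RegularAt r (x + 1) := by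
    intro x hx hr
    apply RegularAt.of_ratShift
    have : ratShift r = ratC q⁻¹ * (r + ratC (-1) * h) := by
      have h1 : ratC q⁻¹ * ratC q = 1 := by
        rw [← map_mul, ← C_mul, inv_mul_cancel₀ hq]; simp
      have h2 : ratC (-1) = -1 := by simp [ratC]
      rw [h2]
      have h3 : r + -1 * h = ratC q * ratShift r := by linear_combination -he
      rw [h3, ← mul_assoc, h1, one_mul]
    rw [this]
    exact (hr.add ((hh x hx).const_mul _)).const_mul _
  have hpe : ∀ x : ℝ, x ≠ -1 → RegularAt r (x + 1) → RegularAt r x := by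
    intro x hx hr
    have : r = ratC q * ratShift r + h := by linear_combination -he
    rw [this]
    exact (hr.ratShift.const_mul _).add (hh x hx)
  have hneg : ∀ k : ℕ, k ≤ N → RegularAt r (-1 - (N : ℝ) + k) := by
    intro k
    induction k with
    | zero =>
      intro _
      apply hB
      rw [abs_of_nonpos] <;> push_cast <;> linarith [(Nat.cast_nonneg N : (0 : ℝ) ≤ N)]
    | succ k ih =>
      intro hk
      have := hne _ ?_ (ih (by omega))
      · push_cast; rw [← add_assoc]; exact this
      · have : (k : ℝ) < N := by exact_mod_cast hk
        linarith
  have hpos : ∀ k : ℕ, k ≤ N + 1 → RegularAt r ((N : ℝ) + 1 - k) := by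
    intro k
    induction k with
    | zero =>
      intro _
      apply hB
      rw [abs_of_nonneg] <;> push_cast <;> linarith [(Nat.cast_nonneg N : (0 : ℝ) ≤ N)]
    | succ k ih =>
      intro hk
      apply hpe
      · have : ((k + 1 : ℕ) : ℝ) ≤ (N : ℝ) + 1 := by exact_mod_cast hk
        linarith
      · have := ih (by omega)
        convert this using 1
        push_cast; ring
  have h1 : RegularAt r (-1) := by simpa using hneg N le_rfl
  have h2 : RegularAt r (-1 + 1) := by simpa using hpos (N + 1) le_rfl
  have : h = r + ratC (-q) * ratShift r := by
    have h2 : ratC (-q) = -ratC q := by simp [ratC]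
    rw [h2]; linear_combination he
  rw [this]
  exact h1.add (h2.ratShift.const_mul _)

/-- The rational function `X + 1`. -/
abbrev ratX1 : RatFunc ℝ := algebraMap ℝ[X] (RatFunc ℝ) (X + 1)

theorem ratX1_ne_zero : ratX1 ≠ 0 := by
  rw [show ratX1 = algebraMap ℝ[X] (RatFunc ℝ) (X + C 1) by simp [ratX1]]
  simpa only [ne_eq, map_eq_zero_iff _ algebraMap_ratFunc_injective] using X_add_C_ne_zero 1

theorem regularAt_inv_pow (e : ℕ) {x : ℝ} (hx : x ≠ -1) : RegularAt (ratX1 ^ e)⁻¹ x := by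
  refine ⟨1, (X + 1) ^ e, ?_, ?_⟩
  · simp only [eval_pow, eval_add, eval_X, eval_one]
    exact pow_ne_zero _ fun h => hx (by linarith)
  · rw [map_pow, map_one]
    exact inv_mul_cancel₀ (pow_ne_zero _ ratX1_ne_zero)

theorem regularAt_sum {ι : Type*} (s : Finset ι) (f : ι → RatFunc ℝ) (x : ℝ)
    (h : ∀ i ∈ s, RegularAt (f i) x) : RegularAt (∑ i ∈ s, f i) x := by
  classical
  induction s using Finset.induction_on with
  | empty => exact ⟨0, 1, by simp, by simp⟩
  | insert a s ha ih =>
    rw [Finset.sum_insert ha]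
    exact (h a (Finset.mem_insert_self a s)).add
      (ih fun i hi => h i (Finset.mem_insert_of_mem hi))

/-- A polar part at `-1` with a nonzero coefficient does have a pole there. -/
theorem eq_zero_of_regularAt_polarPart {ι : Type*} (s : Finset ι) (e : ι → ℕ)
    (he : Set.InjOn e s) (k : ι → ℝ)
    (h : RegularAt (∑ i ∈ s, ratC (k i) * (ratX1 ^ (e i + 1))⁻¹) (-1)) :
    ∀ i ∈ s, k i = 0 := by
  classical
  by_contra! hne
  have hs : (s.filter (fun i => k i ≠ 0)).Nonempty := by
    obtain ⟨i, hi, hk⟩ := hne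
    exact ⟨i, by simp [hi, hk]⟩
  obtain ⟨j, hj, hmax⟩ := Finset.exists_max_image _ e hs
  rw [Finset.mem_filter] at hj
  obtain ⟨p, q, hq, hpq⟩ := h
  have h1 : (∑ i ∈ s, ratC (k i) * (ratX1 ^ (e i + 1))⁻¹) * ratX1 ^ (e j + 1) =
      algebraMap ℝ[X] (RatFunc ℝ) (∑ i ∈ s, C (k i) * (X + 1) ^ (e j - e i)) := by
    rw [Finset.sum_mul, map_sum]
    refine Finset.sum_congr rfl fun i hi => ?_
    by_cases hki : k i = 0
    · simp [hki]
    · have hle : e i ≤ e j := hmax i (by simp [hi, hki])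
      rw [map_mul, map_pow, mul_assoc]
      congr 1
      rw [inv_mul_eq_iff_eq_mul₀ (pow_ne_zero _ ratX1_ne_zero), ← pow_add]
      congr 1; omega
  have h2 : (∑ i ∈ s, C (k i) * (X + 1 : ℝ[X]) ^ (e j - e i)) * q = p * (X + 1) ^ (e j + 1) := by
    apply algebraMap_ratFunc_injective
    rw [map_mul, map_mul, ← h1, ← hpq, map_pow]; ring
  have h3 := congrArg (eval (-1 : ℝ)) h2
  rw [eval_mul, eval_finsetSum, Finset.sum_eq_single j] at h3
  · simp [hq, hj.2] at h3
  · intro i hi hij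
    by_cases hki : k i = 0
    · simp [hki]
    · have hle : e i ≤ e j := hmax i (by simp [hi, hki])
      have hlt : e i ≠ e j := fun h => hij (he hi hj.1 h)
      have : e j - e i ≠ 0 := by omega
      simp [this]
  · intro h; exact absurd hj.1 h

/-! ### Linear independence of the sums -/

/-- Germs at infinity of real sequences. -/
abbrev SeqGerm : Type := Germ (atTop : Filter ℕ) ℝ

/-- The shift `f(n) ↦ f(n + 1)` on germs of sequences. -/
def germShift : SeqGerm →+* SeqGerm where
  toFun f := f.compTendsto (fun n : ℕ => n + 1) (tendsto_add_atTop_nat 1)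
  map_one' := rfl
  map_zero' := rfl
  map_mul' f g := by
    induction f using Germ.inductionOn
    induction g using Germ.inductionOn
    rfl
  map_add' f g := by
    induction f using Germ.inductionOn
    induction g using Germ.inductionOn
    rfl

theorem germShift_coe (f : ℕ → ℝ) :
    germShift (f : SeqGerm) = ((fun n => f (n + 1) : ℕ → ℝ) : SeqGerm) := rfl

/-- The germ of the sequence `p(0), p(1), …`. -/
def polyGerm : ℝ[X] →+* SeqGerm :=
  (Germ.coeRingHom atTop).comp (RingHom.pi fun n : ℕ => evalRingHom (n : ℝ))

theorem polyGerm_apply (p : ℝ[X]) :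
    polyGerm p = ((fun n : ℕ => p.eval (n : ℝ) : ℕ → ℝ) : SeqGerm) := rfl

theorem isUnit_polyGerm (p : nonZeroDivisors ℝ[X]) : IsUnit (polyGerm p) := by
  have hp : (p : ℝ[X]) ≠ 0 := nonZeroDivisors.ne_zero p.2
  refine IsUnit.of_mul_eq_one
    ((fun n : ℕ => ((p : ℝ[X]).eval (n : ℝ))⁻¹ : ℕ → ℝ) : SeqGerm) ?_
  rw [polyGerm_apply, ← Germ.coe_mul, ← Germ.coe_one, Germ.coe_eq]
  filter_upwards [eventually_eval_natCast_ne_zero hp] with n hn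
  exact mul_inv_cancel₀ hn

/-- The germ at infinity of a rational function. -/
def ratGerm : RatFunc ℝ →+* SeqGerm := IsLocalization.lift isUnit_polyGerm

theorem ratGerm_algebraMap (p : ℝ[X]) :
    ratGerm (algebraMap ℝ[X] (RatFunc ℝ) p) = polyGerm p := IsLocalization.lift_eq _ _

theorem germShift_ratGerm (r : RatFunc ℝ) : germShift (ratGerm r) = ratGerm (ratShift r) := by
  have : germShift.comp ratGerm = ratGerm.comp ratShift := by
    apply IsLocalization.ringHom_ext (nonZeroDivisors ℝ[X])
    ext p
    · simp only [RingHom.comp_apply, ratGerm_algebraMap, ratShift_algebraMap, polyGerm_apply,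
        germShift_coe, eval_C, C_comp]
    · simp only [RingHom.comp_apply, ratGerm_algebraMap, ratShift_algebraMap, polyGerm_apply,
        germShift_coe, eval_X, X_comp, eval_add, eval_one, Nat.cast_add, Nat.cast_one]
  exact congrArg (fun f => f r) this

/-- Words `(a₁,b₁),…,(a_l,b_l)` with `b_i ≠ 0`; the pair `(a,b)` stands for `b^i / i^(a+1)`, so
that every exponent is positive. -/
abbrev UWord : Type := List (ℕ × ℝˣ)

/-- The index of the sum that belongs to a word with shifted exponents. -/
def UWord.toSWord (w : UWord) : SWord := w.map fun p => (p.1 + 1, (p.2 : ℝ))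

theorem UWord.toSWord_injective : Function.Injective UWord.toSWord := by
  apply List.map_injective_iff.2
  rintro ⟨a, b⟩ ⟨a', b'⟩ h
  simpa [Units.ext_iff] using h

/-- The index `(β, w)` stands for the sequence `β^n S_w(n)`. -/
abbrev EIndex : Type := ℝˣ × UWord

/-- The germ of the sequence `β^n S_w(n)`. -/
def expSumGerm (i : EIndex) : SeqGerm :=
  ((fun n : ℕ => (i.1 : ℝ) ^ n * sSum i.2.toSWord n : ℕ → ℝ) : SeqGerm)

/-- The value of a formal combination of the sequences `β^n S_w(n)` over the rational functions. -/
def evalComb : (EIndex →₀ RatFunc ℝ) →+ SeqGerm :=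
  Finsupp.liftAddHom fun i => (AddMonoidHom.mulRight (expSumGerm i)).comp ratGerm.toAddMonoidHom

theorem evalComb_single (i : EIndex) (r : RatFunc ℝ) :
    evalComb (Finsupp.single i r) = ratGerm r * expSumGerm i := by
  simp [evalComb]

theorem evalComb_smul (k : RatFunc ℝ) (c : EIndex →₀ RatFunc ℝ) :
    evalComb (k • c) = ratGerm k * evalComb c := by
  induction c using Finsupp.induction_linear with
  | zero => simp
  | add f g hf hg => rw [smul_add, map_add, map_add, hf, hg, mul_add]
  | single i r => rw [Finsupp.smul_single, evalComb_single, evalComb_single, smul_eq_mul, map_mul,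
      mul_assoc]

/-- `β^n S_w(n+1)` as a combination of the sequences `γ^n S_v(n)`. -/
def shiftWord : UWord → ℝˣ → (EIndex →₀ RatFunc ℝ)
  | [], β => Finsupp.single (β, []) 1
  | p :: w, β => Finsupp.single (β, p :: w) 1 +
      (ratC p.2 * (ratX1 ^ (p.1 + 1))⁻¹) • shiftWord w (β * p.2)

theorem ratGerm_ratC (c : ℝ) : ratGerm (ratC c) = ((fun _ => c : ℕ → ℝ) : SeqGerm) := by
  rw [ratGerm_algebraMap, polyGerm_apply]; simp

theorem ratGerm_inv_pow (e : ℕ) : ratGerm (ratX1 ^ e)⁻¹ =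
    ((fun n : ℕ => (((n : ℝ) + 1) ^ e)⁻¹ : ℕ → ℝ) : SeqGerm) := by
  have h1 : ratGerm (ratX1 ^ e) * ratGerm (ratX1 ^ e)⁻¹ = 1 := by
    rw [← map_mul, mul_inv_cancel₀ (pow_ne_zero _ ratX1_ne_zero), map_one]
  have h2 : ((fun n : ℕ => (((n : ℝ) + 1) ^ e)⁻¹ : ℕ → ℝ) : SeqGerm) * ratGerm (ratX1 ^ e)
      = 1 := by
    rw [← map_pow, ratGerm_algebraMap, polyGerm_apply, ← Germ.coe_mul, ← Germ.coe_one]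
    congr 1
    funext n
    have : (n : ℝ) + 1 ≠ 0 := by positivity
    simp [this]
  exact (left_inv_eq_right_inv h2 h1).symm

theorem sSum_succ (p : ℕ × ℝ) (w : SWord) (n : ℕ) :
    sSum (p :: w) (n + 1) = sSum (p :: w) n +
      p.2 ^ (n + 1) / ((n : ℝ) + 1) ^ p.1 * sSum w (n + 1) := by
  simp only [sSum]
  rw [Finset.sum_Icc_succ_top (by omega)]
  push_cast
  rfl

theorem evalComb_shiftWord (w : UWord) (β : ℝˣ) : evalComb (shiftWord w β) =
    ((fun n : ℕ => (β : ℝ) ^ n * sSum (UWord.toSWord w) (n + 1) : ℕ → ℝ) : SeqGerm) := by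
  induction w generalizing β with
  | nil => simp [shiftWord, evalComb_single, expSumGerm, UWord.toSWord, sSum]
  | cons p w ih =>
    rw [shiftWord, map_add, evalComb_single, evalComb_smul, ih, map_one, one_mul, map_mul,
      ratGerm_ratC, ratGerm_inv_pow, expSumGerm, ← Germ.coe_mul, ← Germ.coe_mul, ← Germ.coe_add]
    congr 1
    funext n
    have h := sSum_succ (p.1 + 1, (p.2 : ℝ)) (UWord.toSWord w) n
    simp only [Pi.add_apply, Pi.mul_apply]
    have h2 : UWord.toSWord (p :: w) = (p.1 + 1, (p.2 : ℝ)) :: UWord.toSWord w := rfl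
    rw [h2, h]
    push_cast
    rw [mul_pow, pow_succ, div_eq_mul_inv]
    ring

/-- The shift on formal combinations. -/
def shiftComb : (EIndex →₀ RatFunc ℝ) →+ (EIndex →₀ RatFunc ℝ) :=
  Finsupp.liftAddHom fun i => AddMonoidHom.mk'
    (fun r => (ratShift r * ratC i.1) • shiftWord i.2 i.1) (fun r s => by
      rw [map_add, add_mul, add_smul])

theorem evalComb_shiftComb (c : EIndex →₀ RatFunc ℝ) :
    evalComb (shiftComb c) = germShift (evalComb c) := by
  induction c using Finsupp.induction_linear with
  | zero => simp
  | add f g hf hg => rw [map_add, map_add, map_add, map_add, hf, hg]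
  | single i r =>
    rw [evalComb_single, map_mul, germShift_ratGerm, shiftComb, Finsupp.liftAddHom_apply_single]
    simp only [AddMonoidHom.mk'_apply]
    rw [evalComb_smul, evalComb_shiftWord, map_mul, mul_assoc, ratGerm_ratC, expSumGerm,
      germShift_coe, ← Germ.coe_mul]
    congr 2
    funext n
    simp only [Pi.mul_apply]
    ring

theorem shiftComb_apply (c : EIndex →₀ RatFunc ℝ) (j : EIndex) :
    shiftComb c j = ∑ i ∈ c.support, ratShift (c i) * ratC i.1 * shiftWord i.2 i.1 j := by
  rw [shiftComb, Finsupp.liftAddHom_apply, Finsupp.sum, Finsupp.finsetSum_apply]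
  rfl

theorem shiftWord_apply_of_le (w : UWord) (β : ℝˣ) (j : EIndex) (h : w.length ≤ j.2.length) :
    shiftWord w β j = (if (β, w) = j then 1 else 0) := by
  induction w generalizing β with
  | nil => rw [shiftWord, Finsupp.single_apply]
  | cons p w ih =>
    rw [shiftWord, Finsupp.add_apply, Finsupp.single_apply, Finsupp.smul_apply, ih]
    · rw [if_neg (c := (β * p.2, w) = j), smul_zero, add_zero]
      rintro rfl
      simp at h
    · simp at h; omega

/-- The contribution of `S_{(a,b)w}` to the coefficient of a word that is shorter by one. -/
def dropCoeff : UWord → ℝˣ → EIndex → RatFunc ℝ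
  | [], _, _ => 0
  | p :: w, β, j => if (β * p.2, w) = j then ratC p.2 * (ratX1 ^ (p.1 + 1))⁻¹ else 0

theorem shiftWord_apply_of_le_succ (w : UWord) (β : ℝˣ) (j : EIndex)
    (h : w.length ≤ j.2.length + 1) :
    shiftWord w β j = (if (β, w) = j then 1 else 0) + dropCoeff w β j := by
  cases w with
  | nil => rw [shiftWord, Finsupp.single_apply, dropCoeff, add_zero]
  | cons p w =>
    rw [shiftWord, Finsupp.add_apply, Finsupp.single_apply, Finsupp.smul_apply,
      shiftWord_apply_of_le w _ j (by simpa using h), dropCoeff]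
    split_ifs <;> simp

theorem sum_ite_support (c : EIndex →₀ RatFunc ℝ) (j : EIndex) :
    ∑ i ∈ c.support, ratShift (c i) * ratC i.1 * (if (i.1, i.2) = j then 1 else 0) =
      ratC j.1 * ratShift (c j) := by
  rw [Finset.sum_eq_single j]
  · simp [mul_comm]
  · rintro i - hij; simp [hij]
  · intro h
    rw [Finsupp.notMem_support_iff] at h
    simp [h]

theorem shiftComb_apply_top {c : EIndex →₀ RatFunc ℝ} {D : ℕ}
    (hc : ∀ i ∈ c.support, i.2.length ≤ D) {j : EIndex} (hj : D ≤ j.2.length) :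
    shiftComb c j = ratC j.1 * ratShift (c j) := by
  rw [shiftComb_apply, ← sum_ite_support]
  refine Finset.sum_congr rfl fun i hi => ?_
  rw [shiftWord_apply_of_le _ _ _ ((hc i hi).trans hj)]

theorem shiftComb_apply_sub_top {c : EIndex →₀ RatFunc ℝ} {D : ℕ}
    (hc : ∀ i ∈ c.support, i.2.length ≤ D + 1) {j : EIndex} (hj : D ≤ j.2.length) :
    shiftComb c j = ratC j.1 * ratShift (c j) +
      ∑ i ∈ c.support, ratShift (c i) * ratC i.1 * dropCoeff i.2 i.1 j := by
  rw [shiftComb_apply, ← sum_ite_support, ← Finset.sum_add_distrib]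
  refine Finset.sum_congr rfl fun i hi => ?_
  rw [shiftWord_apply_of_le_succ _ _ _ ((hc i hi).trans (by omega)), mul_add]

/-- A relation whose deepest part has constant coefficients and a single exponential `β₀` cannot
be reproduced by the shift: the words that shorten to the same index would give a polar part at
`-1` only, which no rational function can compensate. -/
theorem coeff_eq_zero_of_shiftComb_eq {c : EIndex →₀ RatFunc ℝ} {D : ℕ} {β₀ : ℝˣ}
    (hc : ∀ i ∈ c.support, i.2.length ≤ D + 1)
    (htop : ∀ i, i.2.length = D + 1 → c i ≠ 0 → i.1 = β₀ ∧ ∃ k : ℝ, c i = ratC k)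
    (hs : shiftComb c = ratC β₀ • c) {i : EIndex} (hi : i.2.length = D + 1) : c i = 0 := by
  classical
  by_contra hci
  obtain ⟨β, w⟩ := i
  obtain _ | ⟨p, w⟩ := w
  · simp at hi
  obtain ⟨rfl, -⟩ := htop _ hi hci
  have hw : w.length = D := by simpa using hi
  set j : EIndex := (β * p.2, w) with hj
  choose! k hk using fun i h h' => (htop i h h').2
  set s := c.support.filter fun i => dropCoeff i.2 i.1 j ≠ 0 with hsdef
  have hshape : ∀ i ∈ s, ∃ a, i = (β, (a, p.2) :: w) := by
    rintro ⟨γ, v⟩ hmem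
    rw [hsdef, Finset.mem_filter, Finsupp.mem_support_iff] at hmem
    obtain ⟨h1, h2⟩ := hmem
    obtain _ | ⟨⟨a, b⟩, v⟩ := v
    · exact absurd rfl h2
    · simp only [dropCoeff] at h2
      rw [ite_ne_right_iff] at h2
      obtain ⟨h3, -⟩ := h2
      rw [hj, Prod.mk.injEq] at h3
      obtain ⟨h3, rfl⟩ := h3
      obtain ⟨h4, -⟩ := htop (γ, (a, b) :: v) (by simpa using hw) h1
      dsimp only at h4
      subst h4
      exact ⟨a, by rw [mul_left_cancel h3]⟩
  have hsum : ∑ i ∈ c.support, ratShift (c i) * ratC i.1 * dropCoeff i.2 i.1 j =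
      ∑ i ∈ s, ratC (k i * β * p.2) * (ratX1 ^ ((i.2.headD (0, 1)).1 + 1))⁻¹ := by
    rw [← Finset.sum_filter_of_ne (p := fun i => dropCoeff i.2 i.1 j ≠ 0)]
    · refine Finset.sum_congr rfl fun i hi => ?_
      have hi' := hi
      obtain ⟨a, rfl⟩ := hshape i hi
      rw [Finset.mem_filter, Finsupp.mem_support_iff] at hi
      rw [hk _ (by simpa using hw) hi.1, ratShift_ratC, dropCoeff, if_pos rfl]
      simp only [List.headD_cons, map_mul, ratC]
      ring
    · intro i _ h h0
      rw [h0, mul_zero] at h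
      exact h rfl
  have heq : ratC (p.2 : ℝ) * ratShift (c j) - c j +
      ratC (β : ℝ)⁻¹ * ∑ i ∈ s, ratC (k i * β * p.2) *
        (ratX1 ^ ((i.2.headD (0, 1)).1 + 1))⁻¹ = 0 := by
    have h1 := congrArg (fun f => f j) hs
    simp only [Finsupp.smul_apply, smul_eq_mul] at h1
    rw [shiftComb_apply_sub_top hc (by simp [hj, hw]), hsum] at h1
    have h2 : ratC (β : ℝ)⁻¹ * ratC (β : ℝ) = 1 := by
      rw [← map_mul, ← C_mul, inv_mul_cancel₀ β.ne_zero]; simp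
    have h3 : ratC (j.1 : ℝ) = ratC (β : ℝ) * ratC (p.2 : ℝ) := by
      rw [← map_mul, ← C_mul]; simp [hj]
    rw [h3] at h1
    linear_combination ratC (β : ℝ)⁻¹ * h1 +
      (c j - ratC (p.2 : ℝ) * ratShift (c j)) * h2
  have hsum' : ratC (β : ℝ)⁻¹ * ∑ i ∈ s, ratC (k i * β * p.2) *
        (ratX1 ^ ((i.2.headD (0, 1)).1 + 1))⁻¹ =
      ∑ i ∈ s, ratC (k i * p.2) * (ratX1 ^ ((i.2.headD (0, 1)).1 + 1))⁻¹ := by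
    rw [Finset.mul_sum]
    refine Finset.sum_congr rfl fun i _ => ?_
    rw [← mul_assoc, ← map_mul, ← C_mul]
    congr 3
    have := β.ne_zero
    field_simp
  rw [hsum'] at heq
  have hreg := regularAt_neg_one p.2.ne_zero heq fun x hx =>
    regularAt_sum _ _ _ fun i _ => (regularAt_inv_pow _ hx).const_mul _
  have hinj : Set.InjOn (fun i : EIndex => (i.2.headD (0, 1)).1) s := by
    intro i hi i' hi' h
    obtain ⟨a, rfl⟩ := hshape i hi
    obtain ⟨a', rfl⟩ := hshape i' hi'
    simp only [List.headD_cons] at h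
    rw [h]
  have hmem : (β, p :: w) ∈ s := by
    rw [hsdef, Finset.mem_filter, Finsupp.mem_support_iff]
    refine ⟨hci, ?_⟩
    simp only [dropCoeff, hj, if_true]
    exact mul_ne_zero (ratC_ne_zero p.2.ne_zero) (inv_ne_zero (pow_ne_zero _ ratX1_ne_zero))
  have h0 := eq_zero_of_regularAt_polarPart s _ hinj _ hreg _ hmem
  have hk0 : k (β, p :: w) = 0 := by
    simpa using h0
  apply hci
  rw [hk _ hi hci, hk0]
  simp [ratC]

/-- Dividing a relation by one of its deepest coefficients and subtracting it from its shift gives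
a relation with fewer deepest terms; if that one is trivial, the relation is invariant under the
shift. -/
theorem exists_normalized_relation {D N : ℕ} (ih : ∀ c : EIndex →₀ RatFunc ℝ,
      (∀ i ∈ c.support, i.2.length ≤ D) →
      (c.support.filter fun i => i.2.length = D).card ≤ N → evalComb c = 0 → c = 0)
    {c : EIndex →₀ RatFunc ℝ} (hc : ∀ i ∈ c.support, i.2.length ≤ D)
    (hN : (c.support.filter fun i => i.2.length = D).card ≤ N + 1) (he : evalComb c = 0)
    {i₀ : EIndex} (hi₀ : i₀.2.length = D) (hci₀ : c i₀ ≠ 0) :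
    ∃ c' : EIndex →₀ RatFunc ℝ, (∀ i ∈ c'.support, i.2.length ≤ D) ∧ evalComb c' = 0 ∧ c' i₀ = 1 ∧
      (∀ i, i.2.length = D → c' i ≠ 0 → i.1 = i₀.1 ∧ ∃ k : ℝ, c' i = ratC k) ∧
      shiftComb c' = ratC i₀.1 • c' := by
  obtain ⟨c', hc'⟩ : ∃ c', c' = (c i₀)⁻¹ • c := ⟨_, rfl⟩
  have hsupp : ∀ i, c' i ≠ 0 → c i ≠ 0 := by
    intro i h h0
    apply h
    rw [hc', Finsupp.smul_apply, h0, smul_zero]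
  have hlen : ∀ i ∈ c'.support, i.2.length ≤ D := fun i hi =>
    hc i (Finsupp.mem_support_iff.2 (hsupp i (Finsupp.mem_support_iff.1 hi)))
  have he' : evalComb c' = 0 := by rw [hc', evalComb_smul, he, mul_zero]
  have h1 : c' i₀ = 1 := by
    rw [hc', Finsupp.smul_apply, smul_eq_mul, inv_mul_cancel₀ hci₀]
  have htopval : ∀ j : EIndex, D ≤ j.2.length →
      (shiftComb c' - ratC i₀.1 • c') j = ratC j.1 * ratShift (c' j) - ratC i₀.1 * c' j := by
    intro j hj
    rw [Finsupp.sub_apply, shiftComb_apply_top hlen hj, Finsupp.smul_apply, smul_eq_mul]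
  have hnz : ∀ j : EIndex, D ≤ j.2.length → (shiftComb c' - ratC i₀.1 • c') j ≠ 0 → c' j ≠ 0 := by
    intro j hj h h0
    apply h
    rw [htopval j hj, h0, map_zero, mul_zero, mul_zero, sub_zero]
  have hzero : shiftComb c' - ratC i₀.1 • c' = 0 := by
    apply ih
    · intro i hi
      rw [Finsupp.mem_support_iff] at hi
      by_contra! hlt
      exact absurd (hlen i (Finsupp.mem_support_iff.2 (hnz i hlt.le hi))) (not_le.2 hlt)
    · rw [← Nat.lt_succ_iff]
      refine (Finset.card_lt_card ?_).trans_le hN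
      rw [Finset.ssubset_iff_of_subset]
      · refine ⟨i₀, by simp [hci₀, hi₀], ?_⟩
        rw [Finset.mem_filter, Finsupp.mem_support_iff, htopval i₀ hi₀.ge, h1]
        simp
      · intro i hi
        rw [Finset.mem_filter, Finsupp.mem_support_iff] at hi ⊢
        exact ⟨hsupp i (hnz i hi.2.ge hi.1), hi.2⟩
    · rw [map_sub, evalComb_shiftComb, evalComb_smul, he', map_zero, mul_zero, sub_zero]
  refine ⟨c', hlen, he', h1, fun i hi hci => ?_, sub_eq_zero.1 hzero⟩
  have h2 := htopval i hi.ge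
  rw [hzero, Finsupp.zero_apply] at h2
  have h3 : ratC ((i₀.1 : ℝ)⁻¹ * i.1) * ratShift (c' i) = c' i := by
    have h4 : ratC (i₀.1 : ℝ)⁻¹ * ratC (i₀.1 : ℝ) = 1 := by
      rw [← map_mul, ← C_mul, inv_mul_cancel₀ i₀.1.ne_zero]; simp
    rw [ratC, C_mul, map_mul]
    linear_combination (c' i) * h4 - ratC (i₀.1 : ℝ)⁻¹ * h2
  obtain ⟨h5, h6⟩ := eq_const_of_mul_ratShift_eq h3 hci
  refine ⟨?_, h6⟩
  rw [inv_mul_eq_one₀ i₀.1.ne_zero] at h5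
  exact (Units.ext h5).symm

theorem expSumGerm_nil_ne_zero (β : ℝˣ) : expSumGerm (β, []) ≠ 0 := by
  intro h
  rw [expSumGerm, ← Germ.coe_zero, Germ.coe_eq] at h
  obtain ⟨n, hn⟩ := h.exists
  simp [UWord.toSWord, sSum] at hn

/-- The sequences `β^n S_w(n)` are linearly independent over the rational functions: a relation of
minimal depth with as few deepest terms as possible can be normalized to be invariant under the
shift, and this is impossible. -/
theorem eq_zero_of_evalComb_eq_zero {c : EIndex →₀ RatFunc ℝ} (he : evalComb c = 0) : c = 0 := by
  have key : ∀ D : ℕ, ∀ c : EIndex →₀ RatFunc ℝ, (∀ i ∈ c.support, i.2.length ≤ D) →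
      evalComb c = 0 → c = 0 := by
    intro D
    induction D with
    | zero =>
      suffices ∀ (N : ℕ) (c : EIndex →₀ RatFunc ℝ), (∀ i ∈ c.support, i.2.length ≤ 0) →
          (c.support.filter fun i => i.2.length = 0).card ≤ N → evalComb c = 0 → c = 0 from
        fun c hc he => this _ c hc le_rfl he
      intro N
      induction N with
      | zero =>
        intro c hc hN _
        rw [Nat.le_zero, Finset.card_eq_zero, Finset.filter_eq_empty_iff] at hN
        rw [← Finsupp.support_eq_empty, Finset.eq_empty_iff_forall_notMem]
        exact fun i hi => hN hi (Nat.le_zero.1 (hc i hi))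
      | succ N ih =>
        intro c hc hN he
        by_contra hne
        obtain ⟨i₀, hi₀⟩ := Finsupp.support_nonempty_iff.2 hne
        obtain ⟨c', hlen, he', h1, htop, -⟩ := exists_normalized_relation ih hc hN he
          (Nat.le_zero.1 (hc i₀ hi₀)) (Finsupp.mem_support_iff.1 hi₀)
        have hnil : ∀ i : EIndex, i.2.length ≤ 0 → i = (i.1, []) := fun i hi => by
          rw [Nat.le_zero, List.length_eq_zero_iff] at hi
          rw [← hi]
        have hsingle : c' = Finsupp.single i₀ 1 := by
          ext i
          rw [Finsupp.single_apply]
          split_ifs with h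
          · rw [← h, h1]
          · by_contra hci
            have hl := hlen i (Finsupp.mem_support_iff.2 hci)
            apply h
            rw [hnil i hl, hnil i₀ (hc i₀ hi₀), (htop i (Nat.le_zero.1 hl) hci).1]
        rw [hsingle, evalComb_single, map_one, one_mul, hnil i₀ (hc i₀ hi₀)] at he'
        exact expSumGerm_nil_ne_zero _ he'
    | succ D ihD =>
      suffices ∀ (N : ℕ) (c : EIndex →₀ RatFunc ℝ), (∀ i ∈ c.support, i.2.length ≤ D + 1) →
          (c.support.filter fun i => i.2.length = D + 1).card ≤ N → evalComb c = 0 → c = 0 from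
        fun c hc he => this _ c hc le_rfl he
      intro N
      induction N with
      | zero =>
        intro c hc hN he
        rw [Nat.le_zero, Finset.card_eq_zero, Finset.filter_eq_empty_iff] at hN
        refine ihD c (fun i hi => ?_) he
        have h1 := hN hi
        have h2 := hc i hi
        omega
      | succ N ih =>
        intro c hc hN he
        by_cases hex : ∃ i₀ ∈ c.support, i₀.2.length = D + 1
        · obtain ⟨i₀, hi₀, hD⟩ := hex
          obtain ⟨c', hlen, -, h1, htop, hs⟩ := exists_normalized_relation ih hc hN he hD
            (Finsupp.mem_support_iff.1 hi₀)
          have := coeff_eq_zero_of_shiftComb_eq hlen htop hs hD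
          rw [h1] at this
          exact absurd this one_ne_zero
        · push Not at hex
          refine ihD c (fun i hi => ?_) he
          have h1 := hex i hi
          have h2 := hc i hi
          omega
  refine key (c.support.sup fun i => i.2.length) c (fun i hi => ?_) he
  exact Finset.le_sup (f := fun i : EIndex => i.2.length) hi

theorem exists_uWord {w : SWord} (hw : ∀ p ∈ w, 1 ≤ p.1 ∧ p.2 ≠ 0) :
    ∃ u : UWord, UWord.toSWord u = w := by
  induction w with
  | nil => exact ⟨[], rfl⟩
  | cons p w ih =>
    obtain ⟨u, hu⟩ := ih fun q hq => hw q (List.mem_cons_of_mem _ hq)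
    obtain ⟨h1, h2⟩ := hw p List.mem_cons_self
    refine ⟨(p.1 - 1, Units.mk0 p.2 h2) :: u, ?_⟩
    rw [← hu]
    simp only [UWord.toSWord, List.map_cons, Units.val_mk0]
    congr 1
    ext <;> simp
    omega

/-- The sums with positive exponents and nonzero `b_i`, including the empty one, are linearly
independent over the reals. -/
theorem eq_zero_of_sum_sSum_eq_zero (t : SWord →₀ ℝ)
    (ht : ∀ w ∈ t.support, ∀ p ∈ w, 1 ≤ p.1 ∧ p.2 ≠ 0)
    (h : ∀ n : ℕ, 1 ≤ n → t.sum (fun v r => r * sSum v n) = 0) : t = 0 := by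
  obtain ⟨t, rfl⟩ : ∃ t' : UWord →₀ ℝ, t'.mapDomain UWord.toSWord = t :=
    ⟨t.comapDomain UWord.toSWord UWord.toSWord_injective.injOn,
      Finsupp.mapDomain_comapDomain _ UWord.toSWord_injective _ fun w hw => exists_uWord (ht w hw)⟩
  obtain ⟨ψ, hψ⟩ : ∃ ψ : UWord → EIndex, ψ = fun u => (1, u) := ⟨_, rfl⟩
  have hinj : Function.Injective ψ := fun u v h => by
    rw [hψ] at h
    exact (Prod.mk.inj h).2
  set c : EIndex →₀ RatFunc ℝ :=
    (Finsupp.mapRange (fun r : ℝ => ratC r) (by simp) t).mapDomain ψ with hc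
  have he : evalComb c = 0 := by
    have h1 : evalComb c = Germ.coeRingHom atTop
        (fun n : ℕ => (t.mapDomain UWord.toSWord).sum (fun v r => r * sSum v n)) := by
      have h2 : (fun n : ℕ => (t.mapDomain UWord.toSWord).sum (fun v r => r * sSum v n)) =
          ∑ u ∈ t.support, fun n : ℕ => t u * sSum (UWord.toSWord u) n := by
        funext n
        rw [Finsupp.sum_mapDomain_index (by simp) (by simp [add_mul]), Finset.sum_apply]
        rfl
      rw [hc, evalComb, Finsupp.liftAddHom_apply,
        Finsupp.sum_mapDomain_index (by simp) (fun _ _ _ => map_add _ _ _),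
        Finsupp.sum_mapRange_index (by simp), h2, map_sum]
      refine Finset.sum_congr rfl fun u _ => ?_
      simp only [AddMonoidHom.comp_apply, AddMonoidHom.coe_mulRight, RingHom.toAddMonoidHom_eq_coe,
        AddMonoidHom.coe_coe, ratGerm_ratC, hψ, expSumGerm, Units.val_one, one_pow, one_mul]
      rfl
    rw [h1]
    change ((fun n : ℕ => (t.mapDomain UWord.toSWord).sum (fun v r => r * sSum v n) : ℕ → ℝ) :
      SeqGerm) = ((0 : ℕ → ℝ) : SeqGerm)
    rw [Germ.coe_eq]
    filter_upwards [eventually_ge_atTop 1] with n hn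
    exact h n hn
  have h0 := eq_zero_of_evalComb_eq_zero he
  rw [hc, ← Finsupp.mapDomain_zero (f := ψ)] at h0
  have h3 := Finsupp.mapDomain_injective hinj h0
  have : t = 0 := by
    ext u
    by_contra hu
    have h4 := congrArg (fun f => f u) h3
    rw [Finsupp.mapRange_apply] at h4
    exact ratC_ne_zero hu h4
  rw [this, Finsupp.mapDomain_zero]

end

/-! ### Uniqueness of the most complicated sum -/

theorem SLess.asymm {v w : SWord} (h : SLess v w) : ¬ SLess w v := by
  unfold SLess at *
  omega

theorem SLess.irrefl (w : SWord) : ¬ SLess w w := fun h => h.asymm h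

theorem IsMostComplicated.unique {m : List ℝ} {c d : ℝ} (hc : c ≠ 0) (hd : d ≠ 0) {w w' : SWord}
    (h : IsMostComplicated m c d w) (h' : IsMostComplicated m c d w') : w = w' := by
  classical
  obtain ⟨hw, p, t₀, t, hp, ht, hM⟩ := h
  obtain ⟨hw', p', t₀', t', hp', ht', hM'⟩ := h'
  by_contra hne
  set T : SWord →₀ ℝ := Finsupp.single w p + Finsupp.single [] t₀ + t -
    (Finsupp.single w' p' + Finsupp.single [] t₀' + t') with hT
  have hT0 : T = 0 := by
    refine eq_zero_of_sum_sSum_eq_zero T (fun v hv => ?_) fun n hn => ?_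
    · have : v = w ∨ v = [] ∨ v ∈ t.support ∨ v = w' ∨ v ∈ t'.support := by
        by_contra! hcon
        obtain ⟨h1, h2, h3, h4, h5⟩ := hcon
        rw [Finsupp.notMem_support_iff] at h3 h5
        rw [Finsupp.mem_support_iff] at hv
        apply hv
        simp [hT, Ne.symm h1, Ne.symm h2, Ne.symm h4, h3, h5]
      rcases this with rfl | rfl | h1 | rfl | h1
      · exact hw.2.1
      · simp
      · exact (ht v h1).1.2.1
      · exact hw'.2.1
      · exact (ht' v h1).1.2.1
    · have h1 := (hM n hn).symm.trans (hM' n hn)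
      have h2 := mul_left_cancel₀ (prefactor_ne_zero hc hd n) h1
      have h3 : ∀ f : SWord →₀ ℝ, f.sum (fun v r => r * sSum v n) =
          Finsupp.linearCombination ℝ (fun v => sSum v n) f := fun f => by
        rw [Finsupp.linearCombination_apply]; rfl
      rw [h3] at h2 ⊢
      rw [h3] at h2
      simp only [hT, map_sub, map_add, Finsupp.linearCombination_single, smul_eq_mul]
      have h4 : sSum [] n = 1 := rfl
      rw [h4]
      linear_combination h2
  have hw0 : w ≠ [] := hw.1
  have hw0' : w' ≠ [] := hw'.1
  have htw : t w = 0 := Finsupp.notMem_support_iff.1 fun hmem => SLess.irrefl w (ht w hmem).2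
  have htw' : t' w' = 0 := Finsupp.notMem_support_iff.1 fun hmem => SLess.irrefl w' (ht' w' hmem).2
  have e1 : T w = 0 := by rw [hT0]; rfl
  have e2 : T w' = 0 := by rw [hT0]; rfl
  have h1 : SLess w w' := by
    refine (ht' w (Finsupp.mem_support_iff.2 fun h0 => hp ?_)).2
    simpa [hT, hw0.symm, Ne.symm hne, htw, h0] using e1
  have h2 : SLess w' w := by
    refine (ht w' (Finsupp.mem_support_iff.2 fun h0 => hp' ?_)).2
    simpa [hT, hw0'.symm, hne, htw', h0] using e2
  exact h1.asymm h2

/-! ### The inverse transform -/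

/-- The data that the program computes do invert the correspondence `m ↦ mellinWord m c d`. -/
theorem IsSBar.inverse_spec {w : SWord} (hw : IsSBar w) :
    IsHBar (poleAndLetters w).tail ∧ |recipProd w| ≠ 0 ∧
      (-Real.sign (recipProd w) = 1 ∨ -Real.sign (recipProd w) = -1) ∧
      mellinWord (poleAndLetters w).tail |recipProd w| (-Real.sign (recipProd w)) = w ∧
      (poleAndLetters w).tail.length + 1 = sWeight w := by
  obtain ⟨h0, h1, h2⟩ := hw
  have hr : recipProd w ≠ 0 := recipProd_ne_zero fun p hp => (h1 p hp).2
  refine ⟨?_, abs_ne_zero.2 hr, neg_sign_eq_one_or hr, ?_, ?_⟩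
  · cases w with
    | nil => exact absurd rfl h0
    | cons p w =>
      rw [poleAndLetters, List.tail_cons, isHBar_replicate_append]
      exact (isHBar_poleAndLetters fun q hq =>
        ⟨(h1 q (List.mem_cons_of_mem _ hq)).2, h2 q hq⟩).1
  · rw [mellinWord, pole_abs_neg_sign hr]
    exact scaleHead_topWord_tail_poleAndLetters h1 h0
  · rw [← length_poleAndLetters fun p hp => (h1 p hp).1]
    cases w with
    | nil => exact absurd rfl h0
    | cons p w => simp [poleAndLetters]

/-- The sequences `α^n M(H_m(x)/(c + d x))(n)`, where `H_m` is an `H̄`-polylogarithm. -/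
def mellinSequences : Set (ℕ → ℝ) :=
  {f | ∃ (α c d : ℝ) (m : List ℝ), (α ≠ 0 ∧ c ≠ 0 ∧ (d = 1 ∨ d = -1) ∧ IsHBar m) ∧
    f = fun n => α ^ n * mellinTransform (hpl m) c d n}

theorem exists_inv_prefactor_eq_pow {c d : ℝ} (hc : c ≠ 0) (hd : d ≠ 0) :
    ∃ α : ℝ, α ≠ 0 ∧ ∀ n, (prefactor c d n)⁻¹ = α ^ n := by
  by_cases h : 0 < pole c d ∧ pole c d ≤ 1
  · exact ⟨1, one_ne_zero, fun n => by simp [prefactor, h]⟩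
  · exact ⟨(pole c d)⁻¹, inv_ne_zero (pole_ne_zero hc hd), fun n => by
      rw [prefactor, if_neg h, inv_pow]⟩

/-- Induction on the weight: the terms that accompany the most complicated sum in the transform
have smaller weight. -/
theorem IsSBar.sSum_mem_span {w : SWord} (hw : IsSBar w) :
    sSum w ∈ Submodule.span ℝ (insert (1 : ℕ → ℝ) mellinSequences) := by
  induction hN : sWeight w using Nat.strong_induction_on generalizing w with
  | _ N ih =>
    subst hN
    set V := Submodule.span ℝ (insert (1 : ℕ → ℝ) mellinSequences)
    obtain ⟨h1, h2, h3, h4, h5⟩ := hw.inverse_spec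
    set c := |recipProd w|
    set d := -Real.sign (recipProd w)
    set m := (poleAndLetters w).tail
    have hd : d ≠ 0 := by rcases h3 with h | h <;> rw [h] <;> norm_num
    obtain ⟨p, t₀, hp, g, hg, hM⟩ := exists_mellinTransform_eq h1 h2 h3
    obtain ⟨α, hα, hpre⟩ := exists_inv_prefactor_eq_pow h2 hd
    have hgV : g ∈ V := by
      have : sumSpan m.length ≤ V := by
        rw [sumSpan, Submodule.span_le]
        rintro _ ⟨v, ⟨hv, hvw⟩, rfl⟩
        exact ih _ (by omega) hv rfl
      exact this hg
    have h1V : (1 : ℕ → ℝ) ∈ V := Submodule.subset_span (Set.mem_insert _ _)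
    have hMV : (fun n => α ^ n * mellinTransform (hpl m) c d n) ∈ V :=
      Submodule.subset_span (Set.mem_insert_of_mem _ ⟨α, c, d, m, ⟨hα, h2, h3, h1⟩, rfl⟩)
    have hS : sSum w = p⁻¹ • ((fun n => α ^ n * mellinTransform (hpl m) c d n) - t₀ • 1 - g) := by
      funext n
      simp only [Pi.smul_apply, Pi.sub_apply, Pi.one_apply, smul_eq_mul]
      rw [← hpre n, hM n, h4, inv_mul_cancel_left₀ (prefactor_ne_zero h2 hd n)]
      field_simp
      ring
    rw [hS]
    exact V.smul_mem _ (V.sub_mem (V.sub_mem hMV (V.smul_mem _ h1V)) hgV)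

end MellinSums

end

open MellinSums
theorem mainTheorem7 :
    -- the Mellin transform of a weighted `H̄`-polylogarithm
    (∀ (m : List ℝ) (c d : ℝ), IsHBar m → c ≠ 0 → (d = 1 ∨ d = -1) →
      (∀ n : ℕ, IntervalIntegrable (mellinIntegrand (hpl m) c d n) MeasureTheory.volume 0 1) ∧
      (∃! w : SWord, IsMostComplicated m c d w) ∧
      ∀ w : SWord, IsMostComplicated m c d w →
        sWeight w = m.length + 1 ∧
        (m ≠ [] → m.getLast? ≠ some 1 → w.getLast? ≠ some (1, 1))) ∧
    -- one algorithm that finds, for every `S̄`-sum, a weighted `H̄`-polylogarithm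
    (∃ P : Prog, ∀ w : SWord, IsSBar w →
      ∃ (m : List ℝ) (c d : ℝ), P.Outputs (encodeSWord w) (c :: d :: m) ∧
        IsHBar m ∧ c ≠ 0 ∧ (d = 1 ∨ d = -1) ∧
        IsMostComplicated m c d w ∧
        m.length + 1 = sWeight w ∧
        (w.getLast? ≠ some (1, 1) → m.getLast? ≠ some 1) ∧
        ((∀ p ∈ w, |p.2| ≤ 1) → 1 ≤ c)) ∧
    -- the inverse Mellin transform
    (∀ w : SWord, IsSBar w →
      ∃ (N : ℕ) (r₀ : ℝ) (r α c d : Fin N → ℝ) (m : Fin N → List ℝ),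
        (∀ j, α j ≠ 0 ∧ c j ≠ 0 ∧ (d j = 1 ∨ d j = -1) ∧ IsHBar (m j)) ∧
        ∀ n : ℕ, 1 ≤ n →
          sSum w n = r₀ + ∑ j, r j * α j ^ n * mellinTransform (hpl (m j)) (c j) (d j) n) := by
  refine ⟨fun m c d hm hc hd => ?_, ⟨inverseProg, fun w hw => ?_⟩, fun w hw => ?_⟩
  · have hd0 : d ≠ 0 := by rcases hd with rfl | rfl <;> norm_num
    have hex := isMostComplicated_mellinWord hm hc hd
    refine ⟨intervalIntegrable_mellinIntegrand hm.lettersGeOne hc hd0,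
      ⟨_, hex, fun w hw => hw.unique hc hd0 hex⟩, fun w hw => ?_⟩
    rw [hw.unique hc hd0 hex]
    exact ⟨(mellinWord_spec hm hc hd0).2, fun h0 h1 =>
      ((endsWell_topWord h0 h1).scaleHead _).getLast?_ne⟩
  · obtain ⟨h1, h2, h3, h4, h5⟩ := hw.inverse_spec
    have hex := isMostComplicated_mellinWord h1 h2 h3
    rw [h4] at hex
    exact ⟨_, _, _, outputs_inverseProg hw.2.1 hw.1, h1, h2, h3, hex, h5,
      getLast?_tail_poleAndLetters_ne hw.2.1, fun hb =>
        one_le_abs_recipProd fun p hp => ⟨(hw.2.1 p hp).2, hb p hp⟩⟩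
  · obtain ⟨r₀, z, hz, hS⟩ := Submodule.mem_span_insert.1 hw.sSum_mem_span
    obtain ⟨N, r, f, rfl⟩ := Submodule.mem_span_set'.1 hz
    choose α c d m hspec hf using fun j => (f j).2
    refine ⟨N, r₀, r, α, c, d, m, hspec, fun n _ => ?_⟩
    rw [hS]
    simp only [Pi.add_apply, Pi.smul_apply, Pi.one_apply, smul_eq_mul, mul_one, Finset.sum_apply]
    congr 1
    refine Finset.sum_congr rfl fun j _ => ?_
    rw [hf j, mul_assoc]
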